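/- Let $\mathbf X(t)$, $t\ge 0$, be the planar symmetric Markov random flight with speed $c>0$ and switching rate $\lambda>0$: a particle starts at the origin of $\mathbb R^2$ in a direction uniformly distributed on the unit circle, moves with constant speed $c$, and at each event of a homogeneous Poisson process of rate $\lambda$ takes a new direction, uniform on the unit circle and independent of everything else. For $r>0$ let $\sigma_r$ denote the uniform probability law on the circle $\{\|\mathbf x\|=r\}$. For $a>0$ and $\varrho>0$ put $$q^{(ac)}(\mathbf x)=\frac{a}{2\pi\varrho}\,\frac{\exp\left(-a+\frac a\varrho\sqrt{\varrho^2-\|\mathbf x\|^2}\right)}{\sqrt{\varrho^2-\|\mathbf x\|^2}}\ \text{ if }\|\mathbf x\|<\varrho,\qquad q^{(ac)}(\mathbf x)=0\ \text{ otherwise}.$$ For every $t>0$ the law of $\mathbf X(t)$ is $e^{-\lambda t}\sigma_{ct}+p^{(ac)}(\mathbf x,t)\,d\mathbf x$, where $$p^{(ac)}(\mathbf x,t)=\frac{\lambda}{2\pi c}\,\frac{\exp\left(-\lambda t+\frac\lambda c\sqrt{c^2t^2-\|\mathbf x\|^2}\right)}{\sqrt{c^2t^2-\|\mathbf x\|^2}}\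 \text{ if }\|\mathbf x\|<ct,\qquad p^{(ac)}(\mathbf x,t)=0\ \text{ otherwise}.$$ Suppose that $\lambda$, $c$ and $t$ vary so that the slow diffusion condition $\lambda\to0$, $c\to0$, $t\to\infty$, $\lambda t\to a>0$, $ct\to\varrho>0$ holds. Then the transition density converges to $$q=e^{-a}\sigma_\varrho+q^{(ac)}(\mathbf x)\,d\mathbf x$$ in the following sense: the singular parts $e^{-\lambda t}\sigma_{ct}$ converge weakly to $e^{-a}\sigma_\varrho$; $p^{(ac)}(\mathbf x,t)\to q^{(ac)}(\mathbf x)$ for every $\mathbf x\in\mathbb R^2$ with $\|\mathbf x\|\ne\varrho$; $q$ is a probability law; and the law of $\mathbf X(t)$ converges weakly to $q$. -/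

import Mathlib

open MeasureTheory ProbabilityTheory Filter Topology

noncomputable section

namespace RandomFlight

/-- The Euclidean plane. -/
abbrev Plane : Type := EuclideanSpace ℝ (Fin 2)

/-- The uniform probability law on the circle of radius `r` centred at the origin: the law of
`(r cos θ, r sin θ)` with `θ` uniform on `(-π, π]`. -/
def uniformCircle (r : ℝ) : Measure Plane :=
  Measure.map (fun θ : ℝ => (!₂[r * Real.cos θ, r * Real.sin θ] : Plane))
    (ENNReal.ofReal (2 * Real.pi)⁻¹ • volume.restrict (Set.Ioc (-Real.pi) Real.pi))

/-- The instant of the `k`-th Poisson event, given the successive waiting times `τ`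
(with `eventTime τ 0 = 0`, the starting time). -/
def eventTime (τ : ℕ → ℝ) (k : ℕ) : ℝ := ∑ j ∈ Finset.range k, τ j

/-- The number of Poisson events that occur in the time interval `(0, t]`. -/
def eventCount (τ : ℕ → ℝ) (t : ℝ) : ℕ := Set.ncard {k : ℕ | eventTime τ (k + 1) ≤ t}

/-- The position at time `t` of a particle that starts at the origin and moves with speed `c`,
in direction `u k` between the `k`-th and the `(k + 1)`-st Poisson event. -/
def position (c : ℝ) (τ : ℕ → ℝ) (u : ℕ → Plane) (t : ℝ) : Plane :=
  c • (∑ k ∈ Finset.range (eventCount τ t), τ k • u k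
    + (t - eventTime τ (eventCount τ t)) • u (eventCount τ t))

/-- `X` is a planar symmetric Markov random flight of speed `c`, governed by a homogeneous Poisson
process of rate `lam` (whose waiting times are independent and exponential of rate `lam`); the
directions are independent, uniform on the unit circle, and independent of the Poisson process. -/
def IsMarkovRandomFlight {Ω : Type*} [MeasurableSpace Ω] (P : Measure Ω) (lam c : ℝ)
    (X : ℝ → Ω → Plane) : Prop :=
  ∃ (τ : ℕ → Ω → ℝ) (u : ℕ → Ω → Plane),
    (∀ k, Measurable (τ k)) ∧ (∀ k, P.map (τ k) = expMeasure lam) ∧ iIndepFun τ P ∧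
    (∀ k, Measurable (u k)) ∧ (∀ k, P.map (u k) = uniformCircle 1) ∧ iIndepFun u P ∧
    IndepFun (fun ω k => τ k ω) (fun ω k => u k ω) P ∧
    ∀ᵐ ω ∂P, ∀ t, 0 ≤ t → X t ω = position c (fun k => τ k ω) (fun k => u k ω) t

/-- The slow diffusion condition, for parameters that vary along a filter `l`. -/
structure SlowDiffusion {ι : Type*} (l : Filter ι) (lam c t : ι → ℝ) (a ρ : ℝ) : Prop where
  rate_tendsto : Tendsto lam l (𝓝 0)
  speed_tendsto : Tendsto c l (𝓝 0)
  time_tendsto : Tendsto t l atTop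
  rate_mul_time : Tendsto (fun i => lam i * t i) l (𝓝 a)
  speed_mul_time : Tendsto (fun i => c i * t i) l (𝓝 ρ)

/-- The absolutely continuous part of the transition density at time `t` of the flight of speed `c`
and rate `lam`. -/
def transitionDensityAC (lam c t : ℝ) (x : Plane) : ℝ :=
  if ‖x‖ < c * t then
    lam / (2 * Real.pi * c)
      * (Real.exp (-(lam * t) + lam / c * √(c ^ 2 * t ^ 2 - ‖x‖ ^ 2))
        / √(c ^ 2 * t ^ 2 - ‖x‖ ^ 2))
  else 0

/-- The transition density at time `t`, singular part included, as a measure on the plane. -/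
def transitionLaw (lam c t : ℝ) : Measure Plane :=
  ENNReal.ofReal (Real.exp (-(lam * t))) • uniformCircle (c * t)
    + volume.withDensity (fun x => ENNReal.ofReal (transitionDensityAC lam c t x))

/-- The absolutely continuous part of the stationary density. -/
def stationaryDensityAC (a ρ : ℝ) (x : Plane) : ℝ :=
  if ‖x‖ < ρ then
    a / (2 * Real.pi * ρ)
      * (Real.exp (-a + a / ρ * √(ρ ^ 2 - ‖x‖ ^ 2)) / √(ρ ^ 2 - ‖x‖ ^ 2))
  else 0

/-- The stationary density, singular part included, as a measure on the plane. -/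
def stationaryLaw (a ρ : ℝ) : Measure Plane :=
  ENNReal.ofReal (Real.exp (-a)) • uniformCircle ρ
    + volume.withDensity (fun x => ENNReal.ofReal (stationaryDensityAC a ρ x))

end RandomFlight

end

noncomputable section

namespace RandomFlight

/-! The law at time `t` depends on the parameters only through `lam * t` and `c * t`
(`transitionLaw_eq`), so the limit theorem is continuity of an explicit two-parameter family of
laws, once that family is identified as the laws of the flight.

The identification is by characteristic functions. At unit speed and frequencies of norm `k`, a leg
of length `r` contributes `J₀(k r)`. Conditioning on `n` events before `s` therefore gives an `(n +
1)`-fold convolution of `r ↦ J₀(k r)`, times `lam ^ n * exp (-lam * s)`. Since `J₀(k ·)` has Laplace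
transform `(p² + k²)^(-1/2)`, the convolution has transform `(p² + k²)^(-(n+1)/2)`; expanding in
`1/p` gives the series in `hasSum_besselMean`. The convolution identity
`integral_bessel_mul_besselMean` is checked on coefficients, by the Beta integral and Vandermonde's
identity, without Laplace transforms.

On the other side, the substitution `r = ρ √(1 - v²)` exhibits the candidate law as a mixture of
uniform circle laws (`integral_stationaryLaw`), and the exponential series turns its characteristic
function into the same sum over `n` (`charFun_stationaryLaw`). The two meet in `map_position`. The
mixture formula also gives weak convergence, its integrand being continuous in both parameters. -/

theorem hasSum_intervalIntegral_of_norm_le {F : ℕ → ℝ → ℝ} {f : ℝ → ℝ} {B : ℕ → ℝ} {a b : ℝ}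
    (hF : ∀ n, Continuous (F n)) (hB : Summable B)
    (hFB : ∀ n, ∀ x ∈ Set.uIoc a b, |F n x| ≤ B n)
    (hf : ∀ x ∈ Set.uIoc a b, HasSum (fun n => F n x) (f x)) :
    HasSum (fun n => ∫ x in a..b, F n x) (∫ x in a..b, f x) :=
  intervalIntegral.hasSum_integral_of_dominated_convergence (fun n _ => B n)
    (fun n => (hF n).aestronglyMeasurable) (fun n => ae_of_all _ (hFB n))
    (ae_of_all _ fun _ _ => hB) intervalIntegrable_const (ae_of_all _ hf)

/-! ### Binomial coefficients and power series of Bessel averages. -/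

/-- The coefficients of the binomial series of `(1 + x) ^ (-(n + 1) / 2)`. -/
def halfChoose (n m : ℕ) : ℝ := Ring.choose (-((n + 1 : ℝ) / 2)) m

theorem halfChoose_zero_right (n : ℕ) : halfChoose n 0 = 1 := by simp [halfChoose]

theorem halfChoose_succ (n m : ℕ) :
    halfChoose n (m + 1) = -(halfChoose n m * (n + 1 + 2 * m) / (2 * (m + 1))) := by
  have h : ((m + 1).factorial : ℝ) = (m + 1) * m.factorial := by
    rw [Nat.factorial_succ]; push_cast; ring
  have h0 : (m.factorial : ℝ) ≠ 0 := by positivity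
  simp only [halfChoose, Ring.choose_eq_smul, descPochhammer_succ_right, Polynomial.smeval_mul,
    smul_eq_mul, h, Polynomial.smeval_sub, Polynomial.smeval_X, Polynomial.smeval_natCast]
  simp
  field_simp
  ring

/-- Compare coefficients in `(1 + x)^(-(n+2)/2) = (1 + x)^(-1/2) (1 + x)^(-(n+1)/2)`. -/
theorem halfChoose_vandermonde (n m : ℕ) :
    halfChoose (n + 1) m
      = ∑ ij ∈ Finset.HasAntidiagonal.antidiagonal m, halfChoose 0 ij.1 * halfChoose n ij.2 := by
  have h : -(((n + 1 : ℕ) + 1 : ℝ) / 2) = -((((0 : ℕ) : ℝ) + 1) / 2) + -((n + 1 : ℝ) / 2) := by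
    push_cast; ring
  rw [halfChoose, h, Ring.add_choose_eq _ (Commute.all _ _)]
  rfl

theorem halfChoose_zero_left (m : ℕ) :
    halfChoose 0 m = (-1) ^ m * ∏ i ∈ Finset.range m, (2 * (i : ℝ) + 1) / (2 * i + 2) := by
  induction m with
  | zero => simp [halfChoose_zero_right]
  | succ m ih =>
    rw [halfChoose_succ, ih, Finset.prod_range_succ, pow_succ]
    push_cast
    field_simp
    ring

/-- A closed form with denominators cleared; the product is the denominator of the moment integral
`integral_pow_mul_one_sub_sq_pow`, against which it cancels. -/
theorem halfChoose_succ_left (n m : ℕ) :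
    halfChoose (n + 1) m * (2 ^ m * m.factorial * ∏ i ∈ Finset.range (m + 1), (n + 1 + 2 * i : ℝ))
        * n.factorial
      = (-1) ^ m * (2 * m + n + 1).factorial := by
  induction m with
  | zero => simp [halfChoose_zero_right, Nat.factorial_succ]
  | succ m ih =>
    rw [Finset.prod_range_succ, halfChoose_succ]
    have h1 : ((2 * (m + 1) + n + 1).factorial : ℝ)
        = (2 * m + n + 3) * ((2 * m + n + 2) * (2 * m + n + 1).factorial) := by
      rw [show 2 * (m + 1) + n + 1 = (2 * m + n + 1) + 1 + 1 by ring, Nat.factorial_succ,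
        Nat.factorial_succ]
      push_cast; ring
    rw [h1, Nat.factorial_succ, pow_succ, pow_succ (-1 : ℝ)]
    push_cast
    have h2 : (m + 1 : ℝ) ≠ 0 := by positivity
    field_simp
    linear_combination (-(2 * m + n + 3) * (2 * m + n + 2)) * ih

theorem integral_cos_pow_two_mul (m : ℕ) :
    ∫ θ in -Real.pi..Real.pi, Real.cos θ ^ (2 * m)
      = 2 * Real.pi * ∏ i ∈ Finset.range m, (2 * (i : ℝ) + 1) / (2 * i + 2) := by
  have hp : Function.Periodic (fun θ : ℝ => Real.cos θ ^ (2 * m)) Real.pi := by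
    intro θ
    simp [Real.cos_add_pi, pow_mul]
  have hc : Continuous (fun θ : ℝ => Real.cos θ ^ (2 * m)) := by fun_prop
  have h0 : ∀ s : ℝ, ∫ θ in s..s + Real.pi, Real.cos θ ^ (2 * m)
      = Real.pi * ∏ i ∈ Finset.range m, (2 * (i : ℝ) + 1) / (2 * i + 2) := by
    intro s
    -- Even powers of the cosine have period `π`; starting the period at `-π / 2` turns the integral
    -- into Wallis' sine integral over `[0, π]`.
    rw [hp.intervalIntegral_add_eq s (-(Real.pi / 2)), ← integral_sin_pow_even]
    have : ∀ θ, Real.sin θ ^ (2 * m) = (fun x => Real.cos x ^ (2 * m)) (θ - Real.pi / 2) := by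
      intro θ
      simp [Real.cos_sub_pi_div_two]
    simp_rw [this]
    rw [intervalIntegral.integral_comp_sub_right (fun x => Real.cos x ^ (2 * m))]
    congr 1 <;> ring
  rw [← intervalIntegral.integral_add_adjacent_intervals (hc.intervalIntegrable _ 0)
    (hc.intervalIntegrable _ _)]
  have h1 := h0 (-Real.pi)
  have h2 := h0 0
  rw [neg_add_cancel] at h1
  rw [zero_add] at h2
  rw [h1, h2]
  ring

/-- The Bessel function `J₀`. -/
def bessel (z : ℝ) : ℝ := (2 * Real.pi)⁻¹ * ∫ θ in -Real.pi..Real.pi, Real.cos (z * Real.cos θ)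

theorem continuous_bessel : Continuous bessel := by
  unfold bessel
  refine continuous_const.mul ?_
  exact intervalIntegral.continuous_parametric_intervalIntegral_of_continuous'
    (by simp only [Function.uncurry_def]; fun_prop) _ _

theorem abs_bessel_le (z : ℝ) : |bessel z| ≤ 1 := by
  have h : ‖∫ θ in -Real.pi..Real.pi, Real.cos (z * Real.cos θ)‖
      ≤ 1 * |Real.pi - -Real.pi| :=
    intervalIntegral.norm_integral_le_of_norm_le_const fun θ _ => by
      simpa using Real.abs_cos_le_one _
  have hpi := Real.pi_pos
  rw [Real.norm_eq_abs, abs_of_pos (by linarith : 0 < Real.pi - -Real.pi)] at h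
  rw [bessel, abs_mul, abs_of_pos (by positivity), inv_mul_le_iff₀ (by positivity)]
  linarith

theorem hasSum_bessel (z : ℝ) :
    HasSum (fun m => halfChoose 0 m * z ^ (2 * m) / (2 * m).factorial) (bessel z) := by
  have h := hasSum_intervalIntegral_of_norm_le (a := -Real.pi) (b := Real.pi)
    (F := fun m θ => (-1) ^ m * (z * Real.cos θ) ^ (2 * m) / (2 * m).factorial)
    (f := fun θ => Real.cos (z * Real.cos θ))
    (B := fun m => |(-1) ^ m * z ^ (2 * m) / (2 * m).factorial|)
    (fun m => by fun_prop) (Real.hasSum_cos z).summable.abs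
    (fun m θ _ => by
      simp only [abs_mul, abs_div, mul_pow, abs_pow]
      gcongr
      exact mul_le_of_le_one_right (by positivity)
        (pow_le_one₀ (abs_nonneg _) (Real.abs_cos_le_one _)))
    (fun θ _ => Real.hasSum_cos _)
  have h2 := h.mul_left (2 * Real.pi)⁻¹
  refine h2.congr_fun fun m => ?_
  have : ∀ θ, (-1) ^ m * (z * Real.cos θ) ^ (2 * m) / (2 * m).factorial
      = ((-1) ^ m * z ^ (2 * m) / (2 * m).factorial) * Real.cos θ ^ (2 * m) := by
    intro θ; rw [mul_pow]; ring
  simp_rw [this]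
  rw [intervalIntegral.integral_const_mul, integral_cos_pow_two_mul, halfChoose_zero_left]
  have := Real.pi_pos.ne'
  field_simp

/-- Splitting off one factor `1 - v ^ 2` raises the exponent of `v` by two, so the induction needs
`n` general. -/
theorem integral_pow_mul_one_sub_sq_pow (n m : ℕ) :
    ∫ v in (0 : ℝ)..1, v ^ n * (1 - v ^ 2) ^ m
      = 2 ^ m * m.factorial / ∏ i ∈ Finset.range (m + 1), (n + 1 + 2 * i : ℝ) := by
  induction m generalizing n with
  | zero => simp
  | succ m ih =>
    have h1 : ∀ v : ℝ, v ^ n * (1 - v ^ 2) ^ (m + 1)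
        = v ^ n * (1 - v ^ 2) ^ m - v ^ (n + 2) * (1 - v ^ 2) ^ m := by
      intro v; ring
    simp_rw [h1]
    rw [intervalIntegral.integral_sub (Continuous.intervalIntegrable (by fun_prop) _ _)
      (Continuous.intervalIntegrable (by fun_prop) _ _), ih, ih]
    set Q := ∏ i ∈ Finset.range m, (n + 1 + 2 * (i + 1) : ℝ) with hQ
    have hQ0 : Q ≠ 0 := by rw [hQ]; exact Finset.prod_ne_zero_iff.2 fun i _ => by positivity
    have e1 : ∏ i ∈ Finset.range (m + 1), (n + 1 + 2 * i : ℝ) = (n + 1) * Q := by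
      rw [Finset.prod_range_succ']; push_cast; ring
    have e2 : ∏ i ∈ Finset.range (m + 1), (((n + 2 : ℕ) : ℝ) + 1 + 2 * i)
        = Q * (n + 1 + 2 * (m + 1)) := by
      rw [Finset.prod_range_succ]; push_cast
      congr 1
      · exact Finset.prod_congr rfl fun i _ => by ring
      · ring
    have e3 : ∏ i ∈ Finset.range (m + 1 + 1), (n + 1 + 2 * i : ℝ)
        = (n + 1) * Q * (n + 1 + 2 * (m + 1)) := by
      rw [Finset.prod_range_succ, e1]; push_cast; ring
    rw [e1, e2, e3, Nat.factorial_succ]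
    have a1 : (n + 1 : ℝ) ≠ 0 := by positivity
    have a2 : (n + 1 + 2 * (m + 1) : ℝ) ≠ 0 := by positivity
    push_cast
    field_simp
    ring

/-- The averages of `J₀` that are proportional to the Bessel functions `J_{n/2}`, up to
a power of the argument. -/
def besselMean : ℕ → ℝ → ℝ
  | 0, z => bessel z
  | n + 1, z => ∫ v in (0 : ℝ)..1, v ^ n / n.factorial * bessel (z * √(1 - v ^ 2))

/-- Integrate the series of `J₀` term by term against `v ^ n / n!`; the moments turn the
coefficients of exponent `-1/2` into those of exponent `-(n+2)/2`. -/
theorem hasSum_besselMean (n : ℕ) (z : ℝ) :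
    HasSum (fun m => halfChoose n m * z ^ (2 * m) / (2 * m + n).factorial) (besselMean n z) := by
  cases n with
  | zero => exact hasSum_bessel z
  | succ n =>
    have h := hasSum_intervalIntegral_of_norm_le (a := 0) (b := 1)
      (F := fun m v => (halfChoose 0 m * z ^ (2 * m) / (2 * m).factorial) / n.factorial
        * (v ^ n * (1 - v ^ 2) ^ m))
      (f := fun v => v ^ n / n.factorial * bessel (z * √(1 - v ^ 2)))
      (B := fun m => |halfChoose 0 m * z ^ (2 * m) / (2 * m).factorial|)
      (fun m => by fun_prop) (hasSum_bessel z).summable.abs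
      (fun m v hv => by
        rw [Set.uIoc_of_le zero_le_one] at hv
        have h1 : 0 ≤ 1 - v ^ 2 := by nlinarith [hv.1, hv.2]
        have h2 : 1 - v ^ 2 ≤ 1 := by nlinarith [hv.1, hv.2]
        rw [abs_mul, abs_div, abs_of_nonneg
          (mul_nonneg (pow_nonneg hv.1.le n) (pow_nonneg h1 m))]
        refine (mul_le_of_le_one_right (by positivity)
          (mul_le_one₀ (pow_le_one₀ hv.1.le hv.2) (by positivity) (pow_le_one₀ h1 h2))).trans ?_
        refine div_le_self (abs_nonneg _) ?_
        rw [Nat.abs_cast]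
        exact_mod_cast Nat.one_le_iff_ne_zero.2 n.factorial_ne_zero)
      (fun v hv => by
        rw [Set.uIoc_of_le zero_le_one] at hv
        have h1 : 0 ≤ 1 - v ^ 2 := by nlinarith [hv.1, hv.2]
        refine ((hasSum_bessel (z * √(1 - v ^ 2))).mul_left (v ^ n / n.factorial)).congr_fun
          fun m => ?_
        rw [mul_pow, pow_mul (√(1 - v ^ 2)), Real.sq_sqrt h1]
        ring)
    refine h.congr_fun fun m => ?_
    rw [intervalIntegral.integral_const_mul, integral_pow_mul_one_sub_sq_pow]
    have e1 := halfChoose_succ_left n m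
    have e2 : halfChoose 0 m * (2 ^ m * m.factorial) ^ 2 = (-1) ^ m * (2 * m).factorial := by
      clear e1 h
      induction m with
      | zero => simp [halfChoose_zero_right]
      | succ m ih =>
        have h1 : ((2 * (m + 1)).factorial : ℝ)
            = (2 * m + 2) * ((2 * m + 1) * (2 * m).factorial) := by
          rw [show 2 * (m + 1) = 2 * m + 1 + 1 by ring, Nat.factorial_succ, Nat.factorial_succ]
          push_cast; ring
        rw [halfChoose_succ, h1, Nat.factorial_succ, pow_succ 2, pow_succ (-1 : ℝ)]
        push_cast
        have h2 : (m + 1 : ℝ) ≠ 0 := by positivity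
        field_simp
        linear_combination (-(2 * m + 1)) * ih
    have p : (∏ i ∈ Finset.range (m + 1), (n + 1 + 2 * i : ℝ)) ≠ 0 :=
      Finset.prod_ne_zero_iff.2 fun i _ => by positivity
    have e3 : (2 * m + (n + 1)).factorial = (2 * m + n + 1).factorial := by rw [add_assoc]
    rw [e3]
    set Q := ∏ i ∈ Finset.range (m + 1), (n + 1 + 2 * i : ℝ)
    have f1 : ((2 * m).factorial : ℝ) ≠ 0 := by positivity
    have f2 : ((2 * m + n + 1).factorial : ℝ) ≠ 0 := by positivity
    have f3 : (m.factorial : ℝ) ≠ 0 := by positivity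
    have f4 : (n.factorial : ℝ) ≠ 0 := by positivity
    have e4 : ((-1 : ℝ) ^ m) * (-1) ^ m = 1 := by rw [← mul_pow]; simp
    have a1 : halfChoose 0 m = (-1) ^ m * (2 * m).factorial / (2 ^ m * m.factorial) ^ 2 := by
      rw [← e2]; field_simp
    have a2 : halfChoose (n + 1) m
        = (-1) ^ m * (2 * m + n + 1).factorial / (2 ^ m * m.factorial * Q * n.factorial) := by
      rw [← e1]; field_simp
    rw [a1, a2]
    field_simp

theorem besselMean_zero (n : ℕ) : besselMean n 0 = (n.factorial : ℝ)⁻¹ := by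
  refine (hasSum_besselMean n 0).unique ?_
  convert hasSum_single (f := fun m => halfChoose n m * 0 ^ (2 * m) / (2 * m + n).factorial) 0
    (fun m hm => by simp [hm]) using 1
  simp [halfChoose_zero_right]

theorem continuous_besselMean (n : ℕ) : Continuous (besselMean n) := by
  cases n with
  | zero => exact continuous_bessel
  | succ n =>
    refine intervalIntegral.continuous_parametric_intervalIntegral_of_continuous' ?_ _ _
    have := continuous_bessel
    simp only [Function.uncurry_def]
    fun_prop

/-! ### Convolution with `J₀` and the generating function. -/

theorem integral_pow_mul_sub_pow (p q : ℕ) (t : ℝ) :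
    ∫ r in (0 : ℝ)..t, r ^ p * (t - r) ^ q
      = p.factorial * q.factorial / (p + q + 1).factorial * t ^ (p + q + 1) := by
  induction q generalizing p with
  | zero =>
    simp [integral_pow, Nat.factorial_succ]
    field_simp
  | succ q ih =>
    have hu : ∀ x ∈ Set.uIcc 0 t, HasDerivAt (fun r : ℝ => (t - r) ^ (q + 1))
        (-((q + 1) * (t - x) ^ q)) x := by
      intro x _
      have := ((hasDerivAt_id x).const_sub t).pow (q + 1)
      convert! this using 1
      simp
    have hv : ∀ x ∈ Set.uIcc 0 t, HasDerivAt (fun r : ℝ => r ^ (p + 1) / (p + 1)) (x ^ p) x := by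
      intro x _
      have := (hasDerivAt_pow (p + 1) x).div_const (p + 1 : ℝ)
      convert! this using 1
      have : (p + 1 : ℝ) ≠ 0 := by positivity
      push_cast
      field_simp
    have h := intervalIntegral.integral_mul_deriv_eq_deriv_mul hu hv
      (Continuous.intervalIntegrable (by fun_prop) _ _)
      (Continuous.intervalIntegrable (by fun_prop) _ _)
    have e1 : ∀ r : ℝ, r ^ p * (t - r) ^ (q + 1) = (t - r) ^ (q + 1) * r ^ p :=
      fun r => mul_comm _ _
    simp_rw [e1]
    rw [h]
    have e2 : ∀ x : ℝ, -((q + 1) * (t - x) ^ q) * (x ^ (p + 1) / (p + 1))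
        = (-((q + 1 : ℝ) / (p + 1))) * (x ^ (p + 1) * (t - x) ^ q) := by intro x; ring
    simp_rw [e2]
    rw [intervalIntegral.integral_const_mul, ih, show p + 1 + q + 1 = p + (q + 1) + 1 by ring,
      Nat.factorial_succ p, Nat.factorial_succ q]
    have : (p + 1 : ℝ) ≠ 0 := by positivity
    push_cast
    field_simp
    simp

theorem hasSum_sum_antidiagonal_mul {a b : ℕ → ℝ} {x y : ℝ} (ha : HasSum a x) (hb : HasSum b y) :
    HasSum (fun m => ∑ ij ∈ Finset.HasAntidiagonal.antidiagonal m, a ij.1 * b ij.2) (x * y) := by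
  have := (summable_norm_sum_mul_antidiagonal_of_summable_norm ha.summable.norm
    hb.summable.norm).of_norm.hasSum
  rwa [← tsum_mul_tsum_eq_tsum_sum_antidiagonal_of_summable_norm ha.summable.norm
    hb.summable.norm, ha.tsum_eq, hb.tsum_eq] at this

theorem hasSum_intervalIntegral_mul {f g : ℕ → ℝ → ℝ} {A B : ℕ → ℝ} {x y : ℝ → ℝ} {a b : ℝ}
    (hf : ∀ n, Continuous (f n)) (hg : ∀ n, Continuous (g n)) (hA : Summable A) (hB : Summable B)
    (hfA : ∀ n, ∀ r ∈ Set.uIoc a b, |f n r| ≤ A n) (hgB : ∀ n, ∀ r ∈ Set.uIoc a b, |g n r| ≤ B n)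
    (hx : ∀ r ∈ Set.uIoc a b, HasSum (fun n => f n r) (x r))
    (hy : ∀ r ∈ Set.uIoc a b, HasSum (fun n => g n r) (y r)) :
    HasSum (fun m => ∑ ij ∈ Finset.HasAntidiagonal.antidiagonal m,
      ∫ r in a..b, f ij.1 r * g ij.2 r) (∫ r in a..b, x r * y r) := by
  have h := hasSum_intervalIntegral_of_norm_le (a := a) (b := b)
    (F := fun m r => ∑ ij ∈ Finset.HasAntidiagonal.antidiagonal m, f ij.1 r * g ij.2 r)
    (f := fun r => x r * y r) (by fun_prop)
    (hasSum_sum_antidiagonal_mul hA.hasSum hB.hasSum).summable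
    (fun m r hr => (Finset.abs_sum_le_sum_abs _ _).trans (Finset.sum_le_sum fun ij _ => by
      rw [abs_mul]
      exact mul_le_mul (hfA _ r hr) (hgB _ r hr) (abs_nonneg _)
        ((abs_nonneg _).trans (hfA _ r hr))))
    (fun r hr => hasSum_sum_antidiagonal_mul (a := fun n => f n r) (b := fun n => g n r)
      (hx r hr) (hy r hr))
  refine h.congr_fun fun m => ?_
  exact (intervalIntegral.integral_finsetSum
    fun ij _ => Continuous.intervalIntegrable ((hf _).mul (hg _)) _ _).symm

/-- In the Cauchy product of the two series, the Beta integral cancels the factorials of each pair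
of terms. What is left is an antidiagonal sum of binomial coefficients, evaluated by
`halfChoose_vandermonde`. -/
theorem integral_bessel_mul_besselMean (n : ℕ) (k : ℝ) {t : ℝ} (ht : 0 ≤ t) :
    ∫ r in (0 : ℝ)..t, bessel (k * r) * ((t - r) ^ n * besselMean n (k * (t - r)))
      = t ^ (n + 1) * besselMean (n + 1) (k * t) := by
  have h := hasSum_intervalIntegral_mul (a := 0) (b := t)
    (f := fun m r => halfChoose 0 m * (k * r) ^ (2 * m) / (2 * m).factorial)
    (g := fun m r => (t - r) ^ n *
      (halfChoose n m * (k * (t - r)) ^ (2 * m) / (2 * m + n).factorial))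
    (x := fun r => bessel (k * r)) (y := fun r => (t - r) ^ n * besselMean n (k * (t - r)))
    (by fun_prop) (by fun_prop) (hasSum_bessel (k * t)).summable.abs
    ((hasSum_besselMean n (k * t)).summable.mul_left (t ^ n)).abs
    (fun m r hr => by
      rw [Set.uIoc_of_le ht] at hr
      have h1 : |r| ≤ |t| := by rw [abs_of_nonneg hr.1.le, abs_of_nonneg ht]; exact hr.2
      simp only [abs_mul, abs_div, abs_pow]
      gcongr)
    (fun m r hr => by
      rw [Set.uIoc_of_le ht] at hr
      have h1 : |t - r| ≤ |t| := by
        rw [abs_of_nonneg (sub_nonneg.2 hr.2), abs_of_nonneg ht]; linarith [hr.1]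
      simp only [abs_mul, abs_div, abs_pow]
      gcongr)
    (fun r _ => hasSum_bessel _) (fun r _ => (hasSum_besselMean n _).mul_left _)
  refine h.unique (((hasSum_besselMean (n + 1) (k * t)).mul_left (t ^ (n + 1))).congr_fun
    fun m => ?_)
  rw [halfChoose_vandermonde, Finset.sum_mul, Finset.sum_div, Finset.mul_sum]
  refine Finset.sum_congr rfl fun ij hij => ?_
  have e : ∀ r : ℝ, (halfChoose 0 ij.1 * (k * r) ^ (2 * ij.1) / (2 * ij.1).factorial)
        * ((t - r) ^ n * (halfChoose n ij.2 * (k * (t - r)) ^ (2 * ij.2)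
          / (2 * ij.2 + n).factorial))
      = (halfChoose 0 ij.1 * halfChoose n ij.2 * k ^ (2 * ij.1 + 2 * ij.2)
        / ((2 * ij.1).factorial * (2 * ij.2 + n).factorial))
        * (r ^ (2 * ij.1) * (t - r) ^ (2 * ij.2 + n)) := by
    intro r
    rw [mul_pow, mul_pow, pow_add, pow_add]
    field_simp
  simp_rw [e]
  rw [intervalIntegral.integral_const_mul, integral_pow_mul_sub_pow]
  obtain rfl := Finset.HasAntidiagonal.mem_antidiagonal.1 hij
  have e2 : 2 * ij.1 + (2 * ij.2 + n) + 1 = 2 * (ij.1 + ij.2) + (n + 1) := by ring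
  rw [e2, mul_pow, pow_add t, mul_add]
  field_simp

theorem hasSum_pow_mul_besselMean (a z : ℝ) :
    HasSum (fun n => a ^ n * besselMean n z)
      (bessel z + a * ∫ v in (0 : ℝ)..1, Real.exp (a * v) * bessel (z * √(1 - v ^ 2))) := by
  have h := hasSum_intervalIntegral_of_norm_le (a := 0) (b := 1)
    (F := fun n v => a ^ n * (v ^ n / n.factorial * bessel (z * √(1 - v ^ 2))))
    (f := fun v => Real.exp (a * v) * bessel (z * √(1 - v ^ 2)))
    (B := fun n => |a ^ n / n.factorial|)
    (fun n => by have := continuous_bessel; fun_prop)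
    (Real.summable_pow_div_factorial a).abs
    (fun n v hv => by
      rw [Set.uIoc_of_le zero_le_one] at hv
      rw [show a ^ n * (v ^ n / n.factorial * bessel (z * √(1 - v ^ 2)))
        = a ^ n / n.factorial * (v ^ n * bessel (z * √(1 - v ^ 2))) by ring, abs_mul, abs_mul]
      refine mul_le_of_le_one_right (abs_nonneg _) (mul_le_one₀ ?_ (abs_nonneg _)
        (abs_bessel_le _))
      rw [abs_of_nonneg (pow_nonneg hv.1.le n)]
      exact pow_le_one₀ hv.1.le hv.2)
    (fun v _ => by
      have := (NormedSpace.expSeries_div_hasSum_exp (𝔸 := ℝ) (a * v))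
      rw [← Real.exp_eq_exp_ℝ] at this
      refine (this.mul_right (bessel (z * √(1 - v ^ 2)))).congr_fun fun n => ?_
      rw [mul_pow]; ring)
  have h2 := (h.mul_left a)
  -- The term `n = 0` is `J₀` itself, not an average; it will match the singular part of the law.
  rw [← hasSum_nat_add_iff' 1]
  simp only [Finset.range_one, Finset.sum_singleton, pow_zero, one_mul]
  rw [show besselMean 0 z = bessel z from rfl, add_sub_cancel_left]
  refine h2.congr_fun fun n => ?_
  rw [intervalIntegral.integral_const_mul, pow_succ]
  simp only [besselMean]
  ring

/-! ### Polar coordinates and uniform laws on circles. -/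

/-- The point of the plane with polar coordinates `r`, `θ`. -/
def polarPoint (r θ : ℝ) : Plane := !₂[r * Real.cos θ, r * Real.sin θ]

@[fun_prop]
theorem continuous_polarPoint {α : Type*} [TopologicalSpace α] {f g : α → ℝ} (hf : Continuous f)
    (hg : Continuous g) : Continuous (fun x => polarPoint (f x) (g x)) := by
  unfold polarPoint
  refine (PiLp.continuous_toLp 2 (fun _ : Fin 2 => ℝ)).comp (continuous_pi fun i => ?_)
  fin_cases i <;> simp <;> fun_prop

theorem norm_polarPoint (r θ : ℝ) : ‖polarPoint r θ‖ = |r| := by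
  rw [EuclideanSpace.norm_eq, ← Real.sqrt_sq_eq_abs]
  congr 1
  simp [polarPoint, Fin.sum_univ_two]
  linear_combination r ^ 2 * Real.cos_sq_add_sin_sq θ

theorem exists_eq_polarPoint (x : Plane) : ∃ φ, x = polarPoint ‖x‖ φ := by
  have h : ‖(⟨x 0, x 1⟩ : ℂ)‖ = ‖x‖ := by
    rw [EuclideanSpace.norm_eq, Complex.norm_def, Complex.normSq_apply]
    congr 1
    simp [Fin.sum_univ_two]; ring
  refine ⟨Complex.arg ⟨x 0, x 1⟩, ?_⟩
  ext i
  fin_cases i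
  · simp [polarPoint, ← h, Complex.norm_mul_cos_arg]
  · simp [polarPoint, ← h, Complex.norm_mul_sin_arg]

theorem inner_polarPoint (r θ k φ : ℝ) :
    inner ℝ (polarPoint r θ) (polarPoint k φ) = k * r * Real.cos (θ - φ) := by
  simp [polarPoint, PiLp.inner_apply, Fin.sum_univ_two, Real.cos_sub]
  ring

/-- The uniform probability law on `(-π, π]`. -/
def uniformAngle : Measure ℝ :=
  ENNReal.ofReal (2 * Real.pi)⁻¹ • volume.restrict (Set.Ioc (-Real.pi) Real.pi)

instance : IsProbabilityMeasure uniformAngle := by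
  constructor
  have hpi := Real.pi_pos
  rw [uniformAngle, Measure.smul_apply, Measure.restrict_apply_univ, Real.volume_Ioc, smul_eq_mul,
    ← ENNReal.ofReal_mul (by positivity)]
  simp only [sub_neg_eq_add]
  rw [← two_mul, inv_mul_cancel₀ (by positivity), ENNReal.ofReal_one]

theorem uniformCircle_eq_map (r : ℝ) : uniformCircle r = uniformAngle.map (polarPoint r) := rfl

instance (r : ℝ) : IsProbabilityMeasure (uniformCircle r) := by
  rw [uniformCircle_eq_map]
  exact Measure.isProbabilityMeasure_map (by fun_prop)

theorem integral_uniformAngle {E : Type*} [NormedAddCommGroup E] [NormedSpace ℝ E] (f : ℝ → E) :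
    ∫ θ, f θ ∂uniformAngle = (2 * Real.pi)⁻¹ • ∫ θ in -Real.pi..Real.pi, f θ := by
  have hpi := Real.pi_pos
  rw [uniformAngle, integral_smul_measure, ENNReal.toReal_ofReal (by positivity),
    intervalIntegral.integral_of_le (by linarith)]

theorem integral_uniformCircle {E : Type*} [NormedAddCommGroup E] [NormedSpace ℝ E] (r : ℝ)
    {f : Plane → E} (hf : Continuous f) :
    ∫ x, f x ∂uniformCircle r = (2 * Real.pi)⁻¹ • ∫ θ in -Real.pi..Real.pi, f (polarPoint r θ) := by
  rw [uniformCircle_eq_map, integral_map (by fun_prop) hf.aestronglyMeasurable,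
    integral_uniformAngle]

theorem integral_exp_mul_cos (z φ : ℝ) :
    ∫ θ in -Real.pi..Real.pi, Complex.exp ((z * Real.cos (θ - φ) : ℝ) * Complex.I)
      = ∫ θ in -Real.pi..Real.pi, (Real.cos (z * Real.cos θ) : ℂ) := by
  have hper : ∀ f : ℝ → ℂ, (∀ θ, f (θ + 2 * Real.pi) = f θ) → ∀ d,
      ∫ θ in -Real.pi..Real.pi, f (θ - d) = ∫ θ in -Real.pi..Real.pi, f θ := by
    intro f hf d
    rw [intervalIntegral.integral_comp_sub_right f]
    have h := Function.Periodic.intervalIntegral_add_eq (T := 2 * Real.pi) hf (-Real.pi - d)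
      (-Real.pi)
    rw [show -Real.pi - d + 2 * Real.pi = Real.pi - d by ring,
      show -Real.pi + 2 * Real.pi = Real.pi by ring] at h
    exact h
  rw [hper (fun θ => Complex.exp ((z * Real.cos θ : ℝ) * Complex.I))
    (fun θ => by rw [Real.cos_add_two_pi])]
  have hs := hper (fun θ => (Real.sin (z * Real.cos θ) : ℂ))
    (fun θ => by rw [Real.cos_add_two_pi]) Real.pi
  simp only [Real.cos_sub_pi, mul_neg, Real.sin_neg, Complex.ofReal_neg,
    intervalIntegral.integral_neg] at hs
  -- The shift by `π` changes the sign of `cos θ`, so the sine integral equals its own negative.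
  have hs0 : ∫ θ in -Real.pi..Real.pi, (Real.sin (z * Real.cos θ) : ℂ) = 0 := by
    linear_combination (-1 / 2 : ℂ) * hs
  have e : ∀ θ : ℝ, Complex.exp ((z * Real.cos θ : ℝ) * Complex.I)
      = (Real.cos (z * Real.cos θ) : ℂ) + (Real.sin (z * Real.cos θ) : ℂ) * Complex.I := by
    intro θ
    rw [Complex.exp_mul_I, Complex.ofReal_cos, Complex.ofReal_sin]
  simp_rw [e]
  rw [intervalIntegral.integral_add (Continuous.intervalIntegrable (by fun_prop) _ _)
    (Continuous.intervalIntegrable (by fun_prop) _ _), intervalIntegral.integral_mul_const, hs0]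
  simp

theorem charFun_uniformCircle (r : ℝ) (ξ : Plane) :
    charFun (uniformCircle r) ξ = bessel (‖ξ‖ * r) := by
  obtain ⟨φ, hφ⟩ := exists_eq_polarPoint ξ
  rw [charFun_apply, integral_uniformCircle r (by fun_prop)]
  have e : ∀ θ, inner ℝ (polarPoint r θ) ξ = ‖ξ‖ * r * Real.cos (θ - φ) := by
    intro θ
    conv_lhs => rw [hφ]
    exact inner_polarPoint _ _ _ _
  simp_rw [e]
  rw [integral_exp_mul_cos, intervalIntegral.integral_ofReal, bessel]
  simp

/-! ### The candidate law as a mixture of uniform circle laws. -/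

theorem measurable_stationaryDensityAC (a ρ : ℝ) : Measurable (stationaryDensityAC a ρ) := by
  unfold stationaryDensityAC
  exact Measurable.ite (measurableSet_lt (by fun_prop) (by fun_prop)) (by fun_prop) (by fun_prop)

theorem lintegral_plane_eq_polar {f : Plane → ENNReal} (hf : Measurable f) :
    ∫⁻ x, f x = ∫⁻ r in Set.Ioi (0 : ℝ), ∫⁻ θ in Set.Ioo (-Real.pi) Real.pi,
      ENNReal.ofReal r * f (polarPoint r θ) := by
  have h1 : MeasurePreserving (fun p : ℝ × ℝ => (!₂[p.1, p.2] : Plane)) :=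
    (PiLp.volume_preserving_toLp (Fin 2)).comp (volume_preserving_finTwoArrow ℝ).symm
  rw [← h1.lintegral_comp hf, ← lintegral_comp_polarCoord_symm, polarCoord_target,
    Measure.volume_eq_prod, ← Measure.prod_restrict, lintegral_prod]
  · simp [polarPoint]
  · simp only [smul_eq_mul, polarCoord_symm_apply]
    have : Measurable fun p : ℝ × ℝ => (!₂[p.1 * Real.cos p.2, p.1 * Real.sin p.2] : Plane) :=
      (show Continuous fun p : ℝ × ℝ => polarPoint p.1 p.2 by fun_prop).measurable
    have := hf.comp this
    exact Measurable.aemeasurable (by fun_prop)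

/-- The distribution of the absolutely continuous part along `√(1 - ‖x‖² / ρ²)`. -/
def heightMeasure (a : ℝ) : Measure ℝ :=
  (volume.restrict (Set.Ioo 0 1)).withDensity fun v => ENNReal.ofReal (a * Real.exp (-a + a * v))

theorem integral_heightMeasure {E : Type*} [NormedAddCommGroup E] [NormedSpace ℝ E] {a : ℝ}
    (ha : 0 ≤ a) (f : ℝ → E) :
    ∫ v, f v ∂heightMeasure a = ∫ v in (0 : ℝ)..1, (a * Real.exp (-a + a * v)) • f v := by
  rw [heightMeasure, integral_withDensity_eq_integral_toReal_smul (by fun_prop) (by simp),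
    intervalIntegral.integral_of_le zero_le_one, integral_Ioc_eq_integral_Ioo]
  refine integral_congr_ae (ae_of_all _ fun v => ?_)
  simp only
  rw [ENNReal.toReal_ofReal (by positivity)]

theorem heightMeasure_univ {a : ℝ} (ha : 0 < a) :
    heightMeasure a Set.univ = ENNReal.ofReal (1 - Real.exp (-a)) := by
  have hi : IntegrableOn (fun v => a * Real.exp (-a + a * v)) (Set.Ioo 0 1) :=
    (Continuous.integrableOn_Icc (by fun_prop)).mono_set Set.Ioo_subset_Icc_self
  rw [heightMeasure, withDensity_apply _ MeasurableSet.univ, Measure.restrict_univ,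
    ← ofReal_integral_eq_lintegral_ofReal hi (ae_of_all _ fun v => by positivity),
    ← integral_Ioc_eq_integral_Ioo, ← intervalIntegral.integral_of_le zero_le_one]
  congr 1
  have hd : ∀ v ∈ Set.uIcc (0 : ℝ) 1, HasDerivAt (fun v => Real.exp (-a + a * v))
      (a * Real.exp (-a + a * v)) v := by
    intro v _
    have := (((hasDerivAt_id v).const_mul a).const_add (-a)).exp
    convert! this using 1
    simp [mul_comm]
  rw [intervalIntegral.integral_eq_sub_of_hasDerivAt hd
    (Continuous.intervalIntegrable (by fun_prop) _ _)]
  simp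

theorem isFiniteMeasure_heightMeasure {a : ℝ} (ha : 0 < a) : IsFiniteMeasure (heightMeasure a) :=
  ⟨by rw [heightMeasure_univ ha]; exact ENNReal.ofReal_lt_top⟩

/-- With `r = ρ √(1 - v²)` one has `√(ρ² - r²) = ρ v` and `r dr / √(ρ² - r²) = -ρ dv`. The
singularity at the boundary circle disappears, leaving the weight `a exp(-a + a v)` on `(0, 1)`. -/
theorem lintegral_stationaryDensityAC_mul {a ρ : ℝ} (ha : 0 < a) (hρ : 0 < ρ)
    {f : Plane → ENNReal} (hf : Measurable f) :
    ∫⁻ x, ENNReal.ofReal (stationaryDensityAC a ρ x) * f x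
      = ∫⁻ v, ∫⁻ θ, f (polarPoint (ρ * √(1 - v ^ 2)) θ) ∂uniformAngle ∂heightMeasure a := by
  have hpi := Real.pi_pos
  have hmeas : Measurable fun r => ∫⁻ θ, f (polarPoint r θ) ∂uniformAngle :=
    Measurable.lintegral_prod_right' (f := fun p : ℝ × ℝ => f (polarPoint p.1 p.2))
      (hf.comp (show Continuous fun p : ℝ × ℝ => polarPoint p.1 p.2 by fun_prop).measurable)
  rw [lintegral_plane_eq_polar (f := fun x => ENNReal.ofReal (stationaryDensityAC a ρ x) * f x)
    ((measurable_stationaryDensityAC a ρ).ennreal_ofReal.mul hf)]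
  set g : ℝ → ENNReal := fun r => ENNReal.ofReal (a / ρ * r
      * (Real.exp (-a + a / ρ * √(ρ ^ 2 - r ^ 2)) / √(ρ ^ 2 - r ^ 2)))
      * ∫⁻ θ, f (polarPoint r θ) ∂uniformAngle with hg
  have h1 : ∀ r ∈ Set.Ioi (0 : ℝ), (∫⁻ θ in Set.Ioo (-Real.pi) Real.pi, ENNReal.ofReal r *
      (ENNReal.ofReal (stationaryDensityAC a ρ (polarPoint r θ)) * f (polarPoint r θ)))
      = (Set.Ioo 0 ρ).indicator g r := by
    intro r hr
    rw [Set.mem_Ioi] at hr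
    by_cases hrρ : r < ρ
    · rw [Set.indicator_of_mem (show r ∈ Set.Ioo 0 ρ from ⟨hr, hrρ⟩)]
      simp only [stationaryDensityAC, norm_polarPoint, abs_of_pos hr, if_pos hrρ, hg]
      simp_rw [← mul_assoc]
      have hfm : Measurable fun θ => f (polarPoint r θ) := hf.comp (by fun_prop)
      rw [lintegral_const_mul _ hfm, uniformAngle, lintegral_smul_measure,
        smul_eq_mul, ← mul_assoc, setLIntegral_congr Ioo_ae_eq_Ioc,
        ← ENNReal.ofReal_mul (by positivity), ← ENNReal.ofReal_mul (by positivity)]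
      congr 2
      field_simp
    · rw [Set.indicator_of_notMem (fun h => hrρ h.2)]
      simp [stationaryDensityAC, norm_polarPoint, abs_of_pos hr, hrρ]
  rw [setLIntegral_congr_fun measurableSet_Ioi h1,
    setLIntegral_indicator measurableSet_Ioo, Set.inter_eq_left.2 Set.Ioo_subset_Ioi_self]
  have hd : ∀ v ∈ Set.Ioo (0 : ℝ) 1, HasDerivWithinAt (fun v => ρ * √(1 - v ^ 2))
      (-(ρ * v / √(1 - v ^ 2))) (Set.Ioo 0 1) v := by
    intro v hv
    have h0 : 0 < 1 - v ^ 2 := by nlinarith [hv.1, hv.2]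
    have := ((((hasDerivAt_pow 2 v).const_sub 1).sqrt h0.ne').const_mul ρ).hasDerivWithinAt
      (s := Set.Ioo 0 1)
    convert! this using 1
    simp
    field_simp
  have hinj : Set.InjOn (fun v => ρ * √(1 - v ^ 2)) (Set.Ioo (0 : ℝ) 1) := by
    intro v hv w hw h
    have h0 : 0 ≤ 1 - v ^ 2 := by nlinarith [hv.1, hv.2]
    have h0' : 0 ≤ 1 - w ^ 2 := by nlinarith [hw.1, hw.2]
    have h2 := mul_left_cancel₀ hρ.ne' h
    rw [Real.sqrt_inj h0 h0'] at h2
    exact (pow_left_inj₀ hv.1.le hw.1.le two_ne_zero).1 (by linarith)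
  have himg : (fun v => ρ * √(1 - v ^ 2)) '' Set.Ioo (0 : ℝ) 1 = Set.Ioo 0 ρ := by
    ext r
    constructor
    · rintro ⟨v, hv, rfl⟩
      have h0 : 0 < 1 - v ^ 2 := by nlinarith [hv.1, hv.2]
      refine ⟨by positivity, mul_lt_of_lt_one_right hρ ?_⟩
      rw [Real.sqrt_lt' one_pos]
      nlinarith [hv.1]
    · intro hr
      have h1 : 0 < r / ρ := div_pos hr.1 hρ
      have h2 : r / ρ < 1 := (div_lt_one hρ).2 hr.2
      have h0 : 0 < 1 - (r / ρ) ^ 2 := by nlinarith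
      refine ⟨√(1 - (r / ρ) ^ 2), ⟨by positivity, ?_⟩, ?_⟩
      · rw [Real.sqrt_lt' one_pos]
        nlinarith
      · simp only
        rw [Real.sq_sqrt h0.le, sub_sub_cancel, Real.sqrt_sq h1.le]
        field_simp
  have hmeas' : Measurable fun v : ℝ =>
      ∫⁻ θ, f (polarPoint (ρ * √(1 - v ^ 2)) θ) ∂uniformAngle := hmeas.comp (by fun_prop)
  rw [← himg, lintegral_image_eq_lintegral_abs_deriv_mul measurableSet_Ioo hd hinj, heightMeasure,
    lintegral_withDensity_eq_lintegral_mul _ (by fun_prop) hmeas']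
  refine setLIntegral_congr_fun measurableSet_Ioo fun v hv => ?_
  have h0 : 0 < 1 - v ^ 2 := by nlinarith [hv.1, hv.2]
  have hv0 := hv.1
  simp only [Pi.mul_apply, hg]
  rw [← mul_assoc, ← ENNReal.ofReal_mul (abs_nonneg _)]
  congr 2
  have e : √(ρ ^ 2 - (ρ * √(1 - v ^ 2)) ^ 2) = ρ * v := by
    rw [mul_pow, Real.sq_sqrt h0.le, show ρ ^ 2 - ρ ^ 2 * (1 - v ^ 2) = (ρ * v) ^ 2 by ring,
      Real.sqrt_sq (by positivity)]
  have hsq : 0 < √(1 - v ^ 2) := Real.sqrt_pos.2 h0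
  rw [e, abs_neg, abs_of_pos (by positivity)]
  field_simp

theorem withDensity_stationaryDensityAC {a ρ : ℝ} (ha : 0 < a) (hρ : 0 < ρ) :
    volume.withDensity (fun x => ENNReal.ofReal (stationaryDensityAC a ρ x))
      = ((heightMeasure a).prod uniformAngle).map
        (fun p => polarPoint (ρ * √(1 - p.1 ^ 2)) p.2) := by
  have := isFiniteMeasure_heightMeasure ha
  have hc : Continuous fun p : ℝ × ℝ => polarPoint (ρ * √(1 - p.1 ^ 2)) p.2 := by fun_prop
  refine Measure.ext_of_lintegral _ fun f hf => ?_
  rw [lintegral_withDensity_eq_lintegral_mul _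
    (measurable_stationaryDensityAC a ρ).ennreal_ofReal hf, lintegral_map hf hc.measurable,
    lintegral_prod (fun p : ℝ × ℝ => f (polarPoint (ρ * √(1 - p.1 ^ 2)) p.2))
      (hf.comp hc.measurable).aemeasurable]
  exact lintegral_stationaryDensityAC_mul ha hρ hf

theorem integral_stationaryDensityAC {E : Type*} [NormedAddCommGroup E] [NormedSpace ℝ E]
    {a ρ : ℝ} (ha : 0 < a) (hρ : 0 < ρ)
    (f : BoundedContinuousFunction Plane E) :
    ∫ x, f x ∂(volume.withDensity (fun x => ENNReal.ofReal (stationaryDensityAC a ρ x)))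
      = ∫ v in (0 : ℝ)..1, (a * Real.exp (-a + a * v)) •
        ∫ x, f x ∂uniformCircle (ρ * √(1 - v ^ 2)) := by
  have := isFiniteMeasure_heightMeasure ha
  have hc : Continuous fun p : ℝ × ℝ => polarPoint (ρ * √(1 - p.1 ^ 2)) p.2 := by fun_prop
  rw [withDensity_stationaryDensityAC ha hρ, integral_map hc.measurable.aemeasurable
    f.continuous.aestronglyMeasurable, integral_prod, integral_heightMeasure ha.le]
  · congr 1
    ext v
    rw [uniformCircle_eq_map, integral_map (by fun_prop) f.continuous.aestronglyMeasurable]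
  · exact Integrable.of_bound (f.continuous.comp hc).aestronglyMeasurable ‖f‖
      (ae_of_all _ fun p => f.norm_coe_le_norm _)

theorem isProbabilityMeasure_stationaryLaw {a ρ : ℝ} (ha : 0 < a) (hρ : 0 < ρ) :
    IsProbabilityMeasure (stationaryLaw a ρ) := by
  have hc : Continuous fun p : ℝ × ℝ => polarPoint (ρ * √(1 - p.1 ^ 2)) p.2 := by fun_prop
  have := isFiniteMeasure_heightMeasure ha
  constructor
  rw [stationaryLaw, withDensity_stationaryDensityAC ha hρ, Measure.add_apply, Measure.smul_apply,
    measure_univ, Measure.map_apply hc.measurable MeasurableSet.univ, Set.preimage_univ,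
    Measure.prod_apply MeasurableSet.univ]
  simp only [Set.preimage_univ, measure_univ, lintegral_one, smul_eq_mul, mul_one]
  rw [heightMeasure_univ ha, ← ENNReal.ofReal_add (Real.exp_pos _).le
    (by simpa using ha.le)]
  simp

theorem integral_stationaryLaw {E : Type*} [NormedAddCommGroup E] [NormedSpace ℝ E]
    {a ρ : ℝ} (ha : 0 < a) (hρ : 0 < ρ)
    (f : BoundedContinuousFunction Plane E) :
    ∫ x, f x ∂stationaryLaw a ρ = Real.exp (-a) • ∫ x, f x ∂uniformCircle ρ
      + ∫ v in (0 : ℝ)..1, (a * Real.exp (-a + a * v)) •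
        ∫ x, f x ∂uniformCircle (ρ * √(1 - v ^ 2)) := by
  have hp := isProbabilityMeasure_stationaryLaw ha hρ
  have hle : volume.withDensity (fun x => ENNReal.ofReal (stationaryDensityAC a ρ x))
      ≤ stationaryLaw a ρ := Measure.le_add_left le_rfl
  have hfin : IsFiniteMeasure
    (volume.withDensity (fun x => ENNReal.ofReal (stationaryDensityAC a ρ x))) :=
    isFiniteMeasure_of_le _ hle
  have hi : ∀ μ : Measure Plane, IsFiniteMeasure μ → Integrable f μ := fun μ _ =>
    Integrable.of_bound f.continuous.aestronglyMeasurable ‖f‖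
      (ae_of_all _ fun p => f.norm_coe_le_norm _)
  rw [stationaryLaw, integral_add_measure ((hi _ inferInstance).smul_measure ENNReal.ofReal_ne_top)
    (hi _ hfin), integral_smul_measure, ENNReal.toReal_ofReal (Real.exp_pos _).le,
    integral_stationaryDensityAC ha hρ]

theorem charFun_stationaryLaw {a ρ : ℝ} (ha : 0 < a) (hρ : 0 < ρ) (ξ : Plane) :
    charFun (stationaryLaw a ρ) ξ
      = (∑' n, Real.exp (-a) * (a ^ n * besselMean n (‖ξ‖ * ρ)) : ℝ) := by
  have hcirc : ∀ r, ∫ x, BoundedContinuousFunction.innerProbChar ξ x ∂uniformCircle r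
      = bessel (‖ξ‖ * r) := fun r => by
    rw [← charFun_eq_integral_innerProbChar, charFun_uniformCircle]
  rw [charFun_eq_integral_innerProbChar, integral_stationaryLaw ha hρ, tsum_mul_left,
    (hasSum_pow_mul_besselMean a (‖ξ‖ * ρ)).tsum_eq]
  simp_rw [hcirc, Complex.real_smul, ← Complex.ofReal_mul]
  rw [intervalIntegral.integral_ofReal, ← Complex.ofReal_add]
  congr 1
  rw [mul_add]
  congr 1
  rw [← intervalIntegral.integral_const_mul, ← intervalIntegral.integral_const_mul]
  congr 1
  ext v
  rw [Real.exp_add]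
  ring_nf

/-! ### Exponential waiting times and the one-step recursion. -/

theorem bessel_abs (z : ℝ) : bessel |z| = bessel z := by
  rcases abs_cases z with h | h <;> simp [h.1, bessel]

theorem integral_expMeasure {E : Type*} [NormedAddCommGroup E] [NormedSpace ℝ E] {lam : ℝ}
    (hlam : 0 < lam) (f : ℝ → E) :
    ∫ r, f r ∂expMeasure lam = ∫ r in Set.Ioi (0 : ℝ), (lam * Real.exp (-(lam * r))) • f r := by
  have hm : Measurable (gammaPDF 1 lam) := (measurable_gammaPDFReal 1 lam).ennreal_ofReal
  rw [expMeasure, gammaMeasure,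
    integral_withDensity_eq_integral_toReal_smul hm (ae_of_all _ fun r => ENNReal.ofReal_lt_top),
    ← integral_Ici_eq_integral_Ioi, ← integral_indicator measurableSet_Ici]
  congr 1
  ext r
  by_cases hr : 0 ≤ r
  · rw [Set.indicator_of_mem (Set.mem_Ici.2 hr), gammaPDF_of_nonneg hr, ENNReal.toReal_ofReal]
    · simp
    · simp; positivity
  · rw [Set.indicator_of_notMem (by simpa using hr), gammaPDF_of_neg (not_le.1 hr)]
    simp

theorem ae_nonneg_expMeasure (lam : ℝ) : ∀ᵐ r ∂expMeasure lam, 0 ≤ r := by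
  have : {a : ℝ | ¬0 ≤ a} = Set.Iio 0 := by ext; simp
  rw [ae_iff, this, expMeasure, gammaMeasure, withDensity_apply _ measurableSet_Iio]
  exact lintegral_gammaPDF_of_nonpos le_rfl

/-- The contribution of the event that exactly `n` Poisson events occur before time `s` to the
characteristic function of the position, at frequencies of norm `k`. -/
def flightKernel (lam k : ℝ) (n : ℕ) (s : ℝ) : ℝ :=
  if 0 ≤ s then lam ^ n * Real.exp (-(lam * s)) * (s ^ n * besselMean n (k * s)) else 0

@[fun_prop]
theorem measurable_flightKernel (lam k : ℝ) (n : ℕ) : Measurable (flightKernel lam k n) := by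
  unfold flightKernel
  have := (continuous_besselMean n).measurable
  exact Measurable.ite measurableSet_Ici (by fun_prop) (by fun_prop)

/-- The factors `exp(-lam r)` and `exp(-lam (s - r))` multiply to a constant, and the kernel
vanishes for `r > s`; this leaves the convolution identity. -/
theorem integral_flightKernel {lam : ℝ} (hlam : 0 < lam) (k : ℝ) (n : ℕ) (s : ℝ) :
    ∫ r, flightKernel lam k n (s - r) * bessel (k * r) ∂expMeasure lam
      = flightKernel lam k (n + 1) s := by
  rw [integral_expMeasure hlam]
  by_cases hs : 0 ≤ s
  · have h1 : ∀ r ∈ Set.Ioi (0 : ℝ), (lam * Real.exp (-(lam * r))) •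
        (flightKernel lam k n (s - r) * bessel (k * r))
        = (Set.Iic s).indicator (fun r => lam ^ (n + 1) * Real.exp (-(lam * s)) *
          (bessel (k * r) * ((s - r) ^ n * besselMean n (k * (s - r))))) r := by
      intro r _
      by_cases hr : r ≤ s
      · rw [Set.indicator_of_mem (Set.mem_Iic.2 hr), flightKernel, if_pos (sub_nonneg.2 hr),
          show -(lam * s) = -(lam * r) + -(lam * (s - r)) by ring, Real.exp_add, smul_eq_mul]
        ring
      · rw [Set.indicator_of_notMem (by simpa using hr), flightKernel,
          if_neg (by simpa using hr)]
        simp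
    rw [setIntegral_congr_fun measurableSet_Ioi h1, setIntegral_indicator measurableSet_Iic,
      Set.Ioi_inter_Iic, ← intervalIntegral.integral_of_le hs,
      intervalIntegral.integral_const_mul, integral_bessel_mul_besselMean n k hs, flightKernel,
      if_pos hs]
  · rw [flightKernel, if_neg hs]
    refine (setIntegral_congr_fun measurableSet_Ioi fun r hr => ?_).trans (integral_zero _ _)
    rw [Set.mem_Ioi] at hr
    simp [flightKernel, show ¬ r ≤ s by linarith]

/-- By the recursion, each kernel is an average of the previous one times `J₀`. The bound gives the
integrability that the Fubini steps need. -/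
theorem abs_flightKernel_le {lam : ℝ} (hlam : 0 < lam) (k : ℝ) (n : ℕ) (s : ℝ) :
    |flightKernel lam k n s| ≤ 1 := by
  have := isProbabilityMeasure_expMeasure hlam
  induction n generalizing s with
  | zero =>
    unfold flightKernel
    split_ifs with h
    · simp only [pow_zero, one_mul]
      rw [abs_mul, Real.abs_exp]
      exact mul_le_one₀ (Real.exp_le_one_iff.2 (by nlinarith)) (abs_nonneg _) (abs_bessel_le _)
    · simp
  | succ n ih =>
    rw [← integral_flightKernel hlam]
    have := norm_integral_le_of_norm_le_const (μ := expMeasure lam) (C := 1)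
      (f := fun r => flightKernel lam k n (s - r) * bessel (k * r))
      (ae_of_all _ fun r => by
        rw [Real.norm_eq_abs, abs_mul]
        exact mul_le_one₀ (ih _) (abs_nonneg _) (abs_bessel_le _))
    simpa using this

theorem integral_indicator_expMeasure {lam : ℝ} (hlam : 0 < lam) {s : ℝ} (hs : 0 ≤ s) :
    ∫ r, (Set.Ioi s).indicator (fun _ => (1 : ℝ)) r ∂expMeasure lam = Real.exp (-(lam * s)) := by
  rw [integral_expMeasure hlam]
  have h1 : ∀ r, (lam * Real.exp (-(lam * r))) • (Set.Ioi s).indicator (fun _ => (1 : ℝ)) r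
      = (Set.Ioi s).indicator (fun r => lam * Real.exp (-(lam * r))) r := by
    intro r
    by_cases hr : r ∈ Set.Ioi s <;> simp [hr]
  simp_rw [h1]
  rw [setIntegral_indicator measurableSet_Ioi, Set.Ioi_inter_Ioi, max_eq_right hs,
    integral_const_mul]
  have e : ∀ r : ℝ, -(lam * r) = -lam * r := fun r => by ring
  simp_rw [e]
  rw [integral_exp_mul_Ioi (by linarith)]
  field_simp

/-- The joint law of a waiting time and a direction. -/
def stepLaw (lam : ℝ) : Measure (ℝ × Plane) := (expMeasure lam).prod (uniformCircle 1)

theorem isProbabilityMeasure_stepLaw {lam : ℝ} (hlam : 0 < lam) :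
    IsProbabilityMeasure (stepLaw lam) := by
  have := isProbabilityMeasure_expMeasure hlam
  unfold stepLaw
  infer_instance

theorem integral_uniformCircle_exp_smul (r : ℝ) (ξ : Plane) :
    ∫ v, Complex.exp ((inner ℝ (r • v) ξ : ℝ) * Complex.I) ∂uniformCircle 1
      = bessel (‖ξ‖ * r) := by
  have h := charFun_uniformCircle 1 (r • ξ)
  rw [charFun_apply] at h
  rw [← bessel_abs (‖ξ‖ * r), abs_mul, abs_norm]
  simp_rw [real_inner_smul_left, ← real_inner_smul_right]
  rw [h, norm_smul, Real.norm_eq_abs, mul_one, mul_comm]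

theorem norm_exp_ofReal_mul_I_le (x : ℝ) : ‖Complex.exp (x * Complex.I)‖ ≤ 1 :=
  (Complex.norm_exp_ofReal_mul_I x).le

theorem integral_stepLaw_flightKernel {lam : ℝ} (hlam : 0 < lam) (ξ : Plane) (n : ℕ) (s : ℝ) :
    ∫ z, (flightKernel lam ‖ξ‖ n (s - z.1) : ℂ) *
        Complex.exp ((inner ℝ (z.1 • z.2) ξ : ℝ) * Complex.I) ∂stepLaw lam
      = flightKernel lam ‖ξ‖ (n + 1) s := by
  have := isProbabilityMeasure_expMeasure hlam
  rw [stepLaw, integral_prod]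
  · simp_rw [integral_const_mul, integral_uniformCircle_exp_smul]
    rw [← integral_flightKernel hlam, ← integral_complex_ofReal]
    simp
  · refine Integrable.of_bound (Measurable.aestronglyMeasurable (by fun_prop)) 1
      (ae_of_all _ fun z => ?_)
    rw [norm_mul, Complex.norm_real]
    exact mul_le_one₀ (abs_flightKernel_le hlam _ _ _) (norm_nonneg _)
      (norm_exp_ofReal_mul_I_le _)

/-- The unfinished last leg: no event occurs for a further time `s`, while the particle keeps its
direction. -/
theorem integral_stepLaw_survival {lam : ℝ} (hlam : 0 < lam) (ξ : Plane) (s : ℝ) :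
    ∫ z, {z : ℝ × Plane | 0 ≤ s ∧ s < z.1}.indicator
        (fun z => Complex.exp ((inner ℝ (s • z.2) ξ : ℝ) * Complex.I)) z ∂stepLaw lam
      = flightKernel lam ‖ξ‖ 0 s := by
  have := isProbabilityMeasure_expMeasure hlam
  rw [flightKernel]
  split_ifs with hs
  · have h : ∀ z : ℝ × Plane, {z : ℝ × Plane | 0 ≤ s ∧ s < z.1}.indicator
        (fun z => Complex.exp ((inner ℝ (s • z.2) ξ : ℝ) * Complex.I)) z
        = (((Set.Ioi s).indicator (fun _ => (1 : ℝ)) z.1 : ℝ) : ℂ)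
          * Complex.exp ((inner ℝ (s • z.2) ξ : ℝ) * Complex.I) := by
      intro z
      by_cases hz : s < z.1 <;> simp [Set.indicator, hs, hz]
    simp_rw [h]
    rw [stepLaw, integral_prod_mul (fun r => (((Set.Ioi s).indicator (fun _ => (1 : ℝ)) r : ℝ) : ℂ))
      (fun v : Plane => Complex.exp ((inner ℝ (s • v) ξ : ℝ) * Complex.I)),
      integral_uniformCircle_exp_smul, integral_complex_ofReal, integral_indicator_expMeasure hlam hs]
    simp [besselMean]
  · simp [hs]

/-- Measurable rectangles form a generating π-system; on them the independence of the two families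
from each other, then within each, factors the probability. -/
theorem iIndepFun_prodMk_of_indepFun {ι Ω α β : Type*} [MeasurableSpace Ω] [MeasurableSpace α]
    [MeasurableSpace β] {P : Measure Ω} {f : ι → Ω → α} {g : ι → Ω → β}
    (hf : ∀ i, Measurable (f i)) (hg : ∀ i, Measurable (g i)) (hfi : iIndepFun f P)
    (hgi : iIndepFun g P) (hfg : IndepFun (fun ω i => f i ω) (fun ω i => g i ω) P) :
    iIndepFun (fun i ω => (f i ω, g i ω)) P := by
  have key : ∀ (s : Finset ι) (A : ι → Set α) (B : ι → Set β),
      (∀ i ∈ s, MeasurableSet (A i)) → (∀ i ∈ s, MeasurableSet (B i)) →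
      P ((⋂ i ∈ s, f i ⁻¹' A i) ∩ ⋂ i ∈ s, g i ⁻¹' B i)
        = (∏ i ∈ s, P (f i ⁻¹' A i)) * ∏ i ∈ s, P (g i ⁻¹' B i) := by
    intro s A B hA hB
    rw [← hfi.measure_inter_preimage_eq_mul s hA, ← hgi.measure_inter_preimage_eq_mul s hB]
    have := hfg.measure_inter_preimage_eq_mul (⋂ i ∈ s, (fun x => x i) ⁻¹' A i)
      (⋂ i ∈ s, (fun x => x i) ⁻¹' B i)
      (Finset.measurableSet_biInter _ fun i hi => measurable_pi_apply i (hA i hi))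
      (Finset.measurableSet_biInter _ fun i hi => measurable_pi_apply i (hB i hi))
    simpa only [Set.preimage_iInter₂, Set.preimage_preimage] using this
  rw [iIndepFun_iff_iIndep]
  refine iIndepSets.iIndep (fun i => ((hf i).prodMk (hg i)).comap_le)
    (fun i => Set.preimage (fun ω => (f i ω, g i ω)) ''
      Set.image2 (· ×ˢ ·) {s : Set α | MeasurableSet s} {t : Set β | MeasurableSet t})
    (fun i => isPiSystem_prod.comap _) (fun i => ?_) ?_
  · rw [← MeasurableSpace.comap_generateFrom, generateFrom_prod]
  · rw [iIndepSets_iff]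
    intro s F hF
    have h : ∀ i, ∃ A : Set α, ∃ B : Set β, i ∈ s → MeasurableSet A ∧ MeasurableSet B ∧
        F i = f i ⁻¹' A ∩ g i ⁻¹' B := by
      intro i
      by_cases hi : i ∈ s
      · obtain ⟨_, ⟨A, hA, B, hB, rfl⟩, h⟩ := hF i hi
        exact ⟨A, B, fun _ => ⟨hA, hB, h.symm⟩⟩
      · exact ⟨∅, ∅, fun h => absurd h hi⟩
    choose A B hAB using h
    rw [Set.iInter₂_congr fun i hi => (hAB i hi).2.2,
      Finset.prod_congr rfl fun i hi => by rw [(hAB i hi).2.2]]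
    have e1 : ⋂ i ∈ s, f i ⁻¹' A i ∩ g i ⁻¹' B i
        = (⋂ i ∈ s, f i ⁻¹' A i) ∩ ⋂ i ∈ s, g i ⁻¹' B i := by
      ext ω; simp only [Set.mem_iInter, Set.mem_inter_iff]; exact forall₂_and
    rw [e1, key s A B (fun i hi => (hAB i hi).1) fun i hi => (hAB i hi).2.1,
      ← Finset.prod_mul_distrib]
    refine Finset.prod_congr rfl fun i hi => ?_
    have := key {i} A B (by simpa using (hAB i hi).1) (by simpa using (hAB i hi).2.1)
    simpa using this.symm

/-! ### The law of the flight, by number of events. -/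

/-- The waiting times and the directions that drive a random flight. -/
structure IsFlightDriver {Ω : Type*} [MeasurableSpace Ω] (P : Measure Ω) (lam : ℝ)
    (τ : ℕ → Ω → ℝ) (u : ℕ → Ω → Plane) : Prop where
  measurable_time : ∀ k, Measurable (τ k)
  map_time : ∀ k, P.map (τ k) = expMeasure lam
  indep_time : iIndepFun τ P
  measurable_dir : ∀ k, Measurable (u k)
  map_dir : ∀ k, P.map (u k) = uniformCircle 1
  indep_dir : iIndepFun u P
  indep : IndepFun (fun ω k => τ k ω) (fun ω k => u k ω) P

/-- The displacement at the `n`-th Poisson event of a flight of unit speed. -/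
def walk (τ : ℕ → ℝ) (u : ℕ → Plane) (n : ℕ) : Plane := ∑ k ∈ Finset.range n, τ k • u k

namespace IsFlightDriver

variable {Ω : Type*} [MeasurableSpace Ω] {P : Measure Ω} {lam : ℝ} {τ : ℕ → Ω → ℝ}
  {u : ℕ → Ω → Plane}

theorem measurable_eventTime (h : IsFlightDriver P lam τ u) (n : ℕ) :
    Measurable fun ω => eventTime (fun k => τ k ω) n :=
  Finset.measurable_sum _ fun k _ => h.measurable_time k

theorem measurable_walk (h : IsFlightDriver P lam τ u) (n : ℕ) :
    Measurable fun ω => walk (fun k => τ k ω) (fun k => u k ω) n :=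
  Finset.measurable_sum _ fun k _ => (h.measurable_time k).smul (h.measurable_dir k)

/-- The event time and the walk at index `n` use only steps of index below `n`, hence are
independent of step `n`. -/
theorem map_prod_step [IsProbabilityMeasure P] (h : IsFlightDriver P lam τ u) (n : ℕ) :
    P.map (fun ω => ((eventTime (fun k => τ k ω) n, walk (fun k => τ k ω) (fun k => u k ω) n),
        (τ n ω, u n ω)))
      = (P.map fun ω => (eventTime (fun k => τ k ω) n,
          walk (fun k => τ k ω) (fun k => u k ω) n)).prod (stepLaw lam) := by
  have hZ := iIndepFun_prodMk_of_indepFun h.measurable_time h.measurable_dir h.indep_time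
    h.indep_dir h.indep
  have hm : ∀ i, Measurable fun ω => (τ i ω, u i ω) := fun i =>
    (h.measurable_time i).prodMk (h.measurable_dir i)
  have h1 := hZ.indepFun_finset (Finset.range n) {n} (by simp) hm
  have hψ : Measurable fun z : ({n} : Finset ℕ) → ℝ × Plane => z ⟨n, by simp⟩ :=
    measurable_pi_apply _
  have h2 := h1.comp
    (φ := fun z : Finset.range n → ℝ × Plane => (∑ i, (z i).1, ∑ i, (z i).1 • (z i).2))
    (by fun_prop) hψ
  have h3 : IndepFun (fun ω => (eventTime (fun k => τ k ω) n,
      walk (fun k => τ k ω) (fun k => u k ω) n)) (fun ω => (τ n ω, u n ω)) P := by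
    convert! h2 using 1
    ext ω : 1
    exact Prod.ext (Finset.sum_coe_sort (Finset.range n) fun k => τ k ω).symm
      (Finset.sum_coe_sort (Finset.range n) fun k => τ k ω • u k ω).symm
  rw [h3.map_prod_eq_prod_map_map
    ((h.measurable_eventTime n).prodMk (h.measurable_walk n)).aemeasurable (hm n).aemeasurable]
  congr 1
  have h4 : IndepFun (τ n) (u n) P :=
    h.indep.comp (φ := fun x : ℕ → ℝ => x n) (ψ := fun x : ℕ → Plane => x n)
      (by fun_prop) (by fun_prop)
  rw [h4.map_prod_eq_prod_map_map (h.measurable_time n).aemeasurable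
    (h.measurable_dir n).aemeasurable, h.map_time, h.map_dir, stepLaw]

theorem integral_step [IsProbabilityMeasure P] (h : IsFlightDriver P lam τ u)
    (hlam : 0 < lam) (n : ℕ)
    {G : ℝ × Plane → ℝ × Plane → ℂ} (hG : Measurable (Function.uncurry G))
    (hG1 : ∀ y z, ‖G y z‖ ≤ 1) :
    ∫ ω, G (eventTime (fun k => τ k ω) n, walk (fun k => τ k ω) (fun k => u k ω) n)
        (τ n ω, u n ω) ∂P
      = ∫ ω, ∫ z, G (eventTime (fun k => τ k ω) n, walk (fun k => τ k ω) (fun k => u k ω) n) z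
        ∂stepLaw lam ∂P := by
  have := isProbabilityMeasure_stepLaw hlam
  have hY : Measurable fun ω => (eventTime (fun k => τ k ω) n,
      walk (fun k => τ k ω) (fun k => u k ω) n) :=
    (h.measurable_eventTime n).prodMk (h.measurable_walk n)
  have := Measure.isProbabilityMeasure_map (μ := P) hY.aemeasurable
  have e := integral_map (μ := P) (f := Function.uncurry G)
    (hY.prodMk ((h.measurable_time n).prodMk (h.measurable_dir n))).aemeasurable
    hG.aestronglyMeasurable
  refine e.symm.trans ?_
  rw [h.map_prod_step, integral_prod]
  · exact integral_map hY.aemeasurable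
      hG.stronglyMeasurable.integral_prod_right'.aestronglyMeasurable
  · exact Integrable.of_bound hG.aestronglyMeasurable 1 (ae_of_all _ fun p => hG1 _ _)

/-- Averaging over the last step removes it from the walk and raises the index of the kernel by one;
hence the induction with `m` general. -/
theorem integral_flightKernel [IsProbabilityMeasure P] (h : IsFlightDriver P lam τ u)
    (hlam : 0 < lam) (ξ : Plane) (t : ℝ)
    (n m : ℕ) :
    ∫ ω, (flightKernel lam ‖ξ‖ m (t - eventTime (fun k => τ k ω) n) : ℂ) *
        Complex.exp ((inner ℝ (walk (fun k => τ k ω) (fun k => u k ω) n) ξ : ℝ) * Complex.I) ∂P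
      = flightKernel lam ‖ξ‖ (n + m) t := by
  induction n generalizing m with
  | zero => simp [eventTime, walk]
  | succ n ih =>
    have e := h.integral_step hlam n (G := fun y z =>
      Complex.exp ((inner ℝ y.2 ξ : ℝ) * Complex.I) *
      ((flightKernel lam ‖ξ‖ m (t - y.1 - z.1) : ℂ) *
        Complex.exp ((inner ℝ (z.1 • z.2) ξ : ℝ) * Complex.I)))
      (by simp only [Function.uncurry_def]; fun_prop)
      (fun y z => by
        rw [norm_mul, norm_mul, Complex.norm_real]
        exact mul_le_one₀ (norm_exp_ofReal_mul_I_le _) (by positivity)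
          (mul_le_one₀ (abs_flightKernel_le hlam _ _ _) (norm_nonneg _)
            (norm_exp_ofReal_mul_I_le _)))
    simp only [integral_const_mul, integral_stepLaw_flightKernel hlam] at e
    rw [show n + 1 + m = n + (m + 1) by ring, ← ih (m + 1)]
    simp_rw [mul_comm (flightKernel lam ‖ξ‖ (m + 1) _ : ℂ)]
    rw [← e]
    congr 1
    ext ω
    simp only [eventTime, walk, Finset.sum_range_succ, inner_add_left, Complex.ofReal_add, add_mul,
      Complex.exp_add, sub_sub]
    ring

/-- The event that exactly `n` Poisson events occur before time `t`. -/
def countEvent (τ : ℕ → Ω → ℝ) (t : ℝ) (n : ℕ) : Set Ω :=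
  {ω | eventTime (fun k => τ k ω) n ≤ t ∧ t < eventTime (fun k => τ k ω) (n + 1)}

theorem measurableSet_countEvent (h : IsFlightDriver P lam τ u) (t : ℝ) (n : ℕ) :
    MeasurableSet (countEvent τ t n) :=
  (measurableSet_le (h.measurable_eventTime n) measurable_const).inter
    (measurableSet_lt measurable_const (h.measurable_eventTime (n + 1)))

theorem setIntegral_countEvent [IsProbabilityMeasure P] (h : IsFlightDriver P lam τ u)
    (hlam : 0 < lam) (ξ : Plane) (t : ℝ)
    (n : ℕ) :
    ∫ ω in countEvent τ t n, Complex.exp ((inner ℝ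
        (walk (fun k => τ k ω) (fun k => u k ω) n
          + (t - eventTime (fun k => τ k ω) n) • u n ω) ξ : ℝ) * Complex.I) ∂P
      = flightKernel lam ‖ξ‖ n t := by
  have e := h.integral_step hlam n (G := fun y z =>
      Complex.exp ((inner ℝ y.2 ξ : ℝ) * Complex.I) *
      {z : ℝ × Plane | 0 ≤ t - y.1 ∧ t - y.1 < z.1}.indicator
        (fun z => Complex.exp ((inner ℝ ((t - y.1) • z.2) ξ : ℝ) * Complex.I)) z)
      (by
        -- The set under the indicator depends on `y`; joint measurability is seen after rewriting
        -- it as a set of pairs.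
        have : (Function.uncurry fun (y z : ℝ × Plane) =>
            Complex.exp ((inner ℝ y.2 ξ : ℝ) * Complex.I) *
            {z : ℝ × Plane | 0 ≤ t - y.1 ∧ t - y.1 < z.1}.indicator
              (fun z => Complex.exp ((inner ℝ ((t - y.1) • z.2) ξ : ℝ) * Complex.I)) z)
            = fun p => Complex.exp ((inner ℝ p.1.2 ξ : ℝ) * Complex.I) *
            {p : (ℝ × Plane) × (ℝ × Plane) | 0 ≤ t - p.1.1 ∧ t - p.1.1 < p.2.1}.indicator
              (fun p => Complex.exp ((inner ℝ ((t - p.1.1) • p.2.2) ξ : ℝ) * Complex.I)) p := by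
          ext p
          simp only [Function.uncurry_def, Set.indicator]
          rfl
        rw [this]
        have s1 : MeasurableSet {p : (ℝ × Plane) × (ℝ × Plane) | 0 ≤ t - p.1.1} :=
          measurableSet_le (by fun_prop) (by fun_prop)
        have s2 : MeasurableSet {p : (ℝ × Plane) × (ℝ × Plane) | t - p.1.1 < p.2.1} :=
          measurableSet_lt (by fun_prop) (by fun_prop)
        exact Measurable.mul (by fun_prop) (Measurable.indicator (by fun_prop) (s1.inter s2)))
      (fun y z => by
        rw [norm_mul]
        refine mul_le_one₀ (norm_exp_ofReal_mul_I_le _) (norm_nonneg _) ?_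
        exact (norm_indicator_le_norm_self _ _).trans (norm_exp_ofReal_mul_I_le _))
  simp only [integral_const_mul, integral_stepLaw_survival hlam] at e
  have e2 := h.integral_flightKernel hlam ξ t n 0
  rw [add_zero] at e2
  rw [← e2]
  simp_rw [mul_comm (flightKernel lam ‖ξ‖ 0 _ : ℂ)]
  rw [← e, ← integral_indicator (h.measurableSet_countEvent t n)]
  congr 1
  ext ω
  have hiff : ω ∈ countEvent τ t n ↔ (τ n ω, u n ω) ∈ {z : ℝ × Plane |
      0 ≤ t - eventTime (fun k => τ k ω) n ∧ t - eventTime (fun k => τ k ω) n < z.1} := by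
    simp only [countEvent, Set.mem_ofPred_eq, eventTime, Finset.sum_range_succ]
    constructor <;> rintro ⟨h1, h2⟩ <;> constructor <;> linarith
  by_cases hω : ω ∈ countEvent τ t n
  · rw [Set.indicator_of_mem hω, Set.indicator_of_mem (hiff.1 hω), inner_add_left,
      Complex.ofReal_add, add_mul, Complex.exp_add]
  · rw [Set.indicator_of_notMem hω, Set.indicator_of_notMem (mt hiff.2 hω), mul_zero]

theorem ae_time_nonneg (h : IsFlightDriver P lam τ u) : ∀ᵐ ω ∂P, ∀ k, 0 ≤ τ k ω := by
  rw [ae_all_iff]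
  intro k
  have := ae_nonneg_expMeasure lam
  rw [← h.map_time k] at this
  exact ae_of_ae_map (h.measurable_time k).aemeasurable this

theorem monotone_eventTime {τ : ℕ → ℝ} (hτ : ∀ k, 0 ≤ τ k) : Monotone (eventTime τ) :=
  monotone_nat_of_le_succ fun n => by
    simp only [eventTime, Finset.sum_range_succ]
    linarith [hτ n]

theorem eventCount_eq {τ : ℕ → ℝ} (hτ : ∀ k, 0 ≤ τ k) {t : ℝ} {n : ℕ} (h1 : eventTime τ n ≤ t)
    (h2 : t < eventTime τ (n + 1)) : eventCount τ t = n := by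
  have : {k : ℕ | eventTime τ (k + 1) ≤ t} = Set.Iio n := by
    ext k
    simp only [Set.mem_ofPred_eq, Set.mem_Iio]
    constructor
    · intro hk
      by_contra hn
      have := monotone_eventTime hτ (show n + 1 ≤ k + 1 by omega)
      linarith
    · intro hk
      exact (monotone_eventTime hτ (show k + 1 ≤ n by omega)).trans h1
  rw [eventCount, this, ← Finset.coe_Iio, Set.ncard_coe_finset]
  simp

theorem aedisjoint_countEvent (h : IsFlightDriver P lam τ u) (t : ℝ) :
    Pairwise (Function.onFun (AEDisjoint P) (countEvent τ t)) := by
  intro m n hmn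
  rw [Function.onFun, AEDisjoint]
  have h0 := h.ae_time_nonneg
  refine measure_mono_null (t := {ω | ¬∀ k, 0 ≤ τ k ω}) (fun ω hω hτ => hmn ?_) (ae_iff.1 h0)
  rw [← eventCount_eq hτ hω.1.1 hω.1.2, ← eventCount_eq hτ hω.2.1 hω.2.2]

/-- At frequency zero the characteristic integrals are the Poisson probabilities, which sum to one.
So almost surely only finitely many events occur by time `t`, and the value `0` of `Set.ncard` on
infinite sets plays no role. -/
theorem iUnion_countEvent_ae_eq_univ [IsProbabilityMeasure P] (h : IsFlightDriver P lam τ u)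
    (hlam : 0 < lam) {t : ℝ}
    (ht : 0 ≤ t) : (⋃ n, countEvent τ t n : Set Ω) =ᵐ[P] Set.univ := by
  have h1 := hasSum_integral_iUnion_ae (f := fun _ => (1 : ℝ))
    (fun n => (h.measurableSet_countEvent t n).nullMeasurableSet)
    (h.aedisjoint_countEvent t) (integrable_const _).integrableOn
  have h2 : ∀ n, ∫ _ in countEvent τ t n, (1 : ℝ) ∂P
      = Real.exp (-(lam * t)) * ((lam * t) ^ n / n.factorial) := by
    intro n
    have e := h.setIntegral_countEvent hlam 0 t n
    simp only [inner_zero_right, Complex.ofReal_zero, zero_mul, Complex.exp_zero, norm_zero,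
      flightKernel, if_pos ht, besselMean_zero] at e
    have e' : ((∫ _ in countEvent τ t n, (1 : ℝ) ∂P : ℝ) : ℂ)
        = ∫ _ in countEvent τ t n, (1 : ℂ) ∂P := by
      rw [← integral_complex_ofReal]; simp
    rw [← e', Complex.ofReal_inj] at e
    rw [e, mul_pow]
    ring
  have h3 := (NormedSpace.expSeries_div_hasSum_exp (𝔸 := ℝ) (lam * t)).mul_left
    (Real.exp (-(lam * t)))
  rw [← Real.exp_eq_exp_ℝ, ← Real.exp_add, neg_add_cancel, Real.exp_zero] at h3
  have h4 := h1.unique (h3.congr_fun h2)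
  rw [setIntegral_const, smul_eq_mul, mul_one] at h4
  rw [ae_eq_univ, prob_compl_eq_zero_iff (MeasurableSet.iUnion (h.measurableSet_countEvent t))]
  rwa [measureReal_def, ENNReal.toReal_eq_one_iff] at h4

theorem position_eq {τ : ℕ → ℝ} (u : ℕ → Plane) (c : ℝ) (hτ : ∀ k, 0 ≤ τ k) {t : ℝ} {n : ℕ}
    (h1 : eventTime τ n ≤ t) (h2 : t < eventTime τ (n + 1)) :
    position c τ u t = c • (walk τ u n + (t - eventTime τ n) • u n) := by
  rw [position, eventCount_eq hτ h1 h2, walk]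

theorem ae_position_eq (h : IsFlightDriver P lam τ u) (c t : ℝ) (n : ℕ) :
    ∀ᵐ ω ∂P.restrict (countEvent τ t n), position c (fun k => τ k ω) (fun k => u k ω) t
      = c • (walk (fun k => τ k ω) (fun k => u k ω) n
          + (t - eventTime (fun k => τ k ω) n) • u n ω) := by
  rw [ae_restrict_iff' (h.measurableSet_countEvent t n)]
  filter_upwards [h.ae_time_nonneg] with ω hω hn
  exact position_eq _ c hω hn.1 hn.2

theorem aemeasurable_position [IsProbabilityMeasure P] (h : IsFlightDriver P lam τ u)
    (hlam : 0 < lam) (c : ℝ) {t : ℝ}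
    (ht : 0 ≤ t) :
    AEMeasurable (fun ω => position c (fun k => τ k ω) (fun k => u k ω) t) P := by
  have h1 : P.restrict (⋃ n, countEvent τ t n) = P := by
    rw [Measure.restrict_congr_set (h.iUnion_countEvent_ae_eq_univ hlam ht), Measure.restrict_univ]
  rw [← h1, aemeasurable_iUnion_iff]
  intro n
  refine AEMeasurable.congr (Measurable.aemeasurable ?_) (EventuallyEq.symm (h.ae_position_eq c t n))
  have := h.measurable_walk n
  have := h.measurable_eventTime n
  have := h.measurable_dir n
  fun_prop

theorem map_position [IsProbabilityMeasure P] (h : IsFlightDriver P lam τ u)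
    (hlam : 0 < lam) {c : ℝ} (hc : 0 < c)
    {t : ℝ} (ht : 0 < t) :
    P.map (fun ω => position c (fun k => τ k ω) (fun k => u k ω) t)
      = stationaryLaw (lam * t) (c * t) := by
  have hX := h.aemeasurable_position hlam c ht.le
  have := isProbabilityMeasure_stationaryLaw (mul_pos hlam ht) (mul_pos hc ht)
  have := Measure.isProbabilityMeasure_map hX
  refine Measure.ext_of_charFun (funext fun ξ => ?_)
  rw [charFun_stationaryLaw (mul_pos hlam ht) (mul_pos hc ht), charFun_apply,
    integral_map hX (Continuous.aestronglyMeasurable (by fun_prop))]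
  have hb : AEStronglyMeasurable (fun ω => Complex.exp
      ((inner ℝ (position c (fun k => τ k ω) (fun k => u k ω) t) ξ : ℝ) * Complex.I)) P := by
    have : Continuous fun x : Plane => Complex.exp ((inner ℝ x ξ : ℝ) * Complex.I) := by fun_prop
    exact (this.measurable.comp_aemeasurable hX).aestronglyMeasurable
  have hs := hasSum_integral_iUnion_ae (μ := P) (f := fun ω => Complex.exp
      ((inner ℝ (position c (fun k => τ k ω) (fun k => u k ω) t) ξ : ℝ) * Complex.I))
    (fun n => (h.measurableSet_countEvent t n).nullMeasurableSet)
    (h.aedisjoint_countEvent t)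
    (Integrable.of_bound hb 1 (ae_of_all _ fun ω => norm_exp_ofReal_mul_I_le _)).integrableOn
  rw [setIntegral_congr_set (h.iUnion_countEvent_ae_eq_univ hlam ht.le), setIntegral_univ] at hs
  rw [← hs.tsum_eq, Complex.ofReal_tsum]
  congr 1
  ext n
  -- The speed is moved into the frequency, `c • ξ`, since the kernels are computed at unit speed.
  rw [integral_congr_ae (g := fun ω => Complex.exp ((inner ℝ
        (walk (fun k => τ k ω) (fun k => u k ω) n
          + (t - eventTime (fun k => τ k ω) n) • u n ω) (c • ξ) : ℝ) * Complex.I)),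
    h.setIntegral_countEvent hlam]
  · rw [flightKernel, if_pos ht.le, norm_smul, Real.norm_eq_abs, abs_of_pos hc, mul_pow,
      show c * ‖ξ‖ * t = ‖ξ‖ * (c * t) by ring]
    congr 1
    ring
  · filter_upwards [h.ae_position_eq c t n] with ω hω
    rw [hω, real_inner_smul_left, real_inner_smul_right]

end IsFlightDriver

/-! ### Scaling, and continuity in the two parameters. -/

theorem transitionDensityAC_eq (lam c : ℝ) {t : ℝ} (ht : t ≠ 0) :
    transitionDensityAC lam c t = stationaryDensityAC (lam * t) (c * t) := by
  ext x
  rw [transitionDensityAC, stationaryDensityAC, mul_pow, mul_div_mul_right _ _ ht, ← mul_assoc,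
    mul_div_mul_right _ _ ht]

theorem transitionLaw_eq (lam c : ℝ) {t : ℝ} (ht : t ≠ 0) :
    transitionLaw lam c t = stationaryLaw (lam * t) (c * t) := by
  rw [transitionLaw, stationaryLaw, transitionDensityAC_eq lam c ht]

theorem continuous_integral_uniformCircle (f : BoundedContinuousFunction Plane ℝ) :
    Continuous fun r => ∫ x, f x ∂uniformCircle r := by
  simp_rw [integral_uniformCircle _ f.continuous]
  simp only [smul_eq_mul]
  refine continuous_const.mul ?_
  refine intervalIntegral.continuous_parametric_intervalIntegral_of_continuous' ?_ _ _
  have := f.continuous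
  simp only [Function.uncurry_def]
  fun_prop

/-- In the mixture formula the domain `[0, 1]` is fixed and the integrand is jointly continuous, so
the moving boundary and singularity of the density cause no trouble. -/
theorem tendsto_integral_stationaryLaw {ι : Type*} {l : Filter ι} {A R : ι → ℝ} {a ρ : ℝ}
    (ha : 0 < a) (hρ : 0 < ρ) (hA : Tendsto A l (𝓝 a)) (hR : Tendsto R l (𝓝 ρ))
    (f : BoundedContinuousFunction Plane ℝ) :
    Tendsto (fun i => ∫ x, f x ∂stationaryLaw (A i) (R i)) l
      (𝓝 (∫ x, f x ∂stationaryLaw a ρ)) := by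
  have hcont : ∀ C : ℝ → ℝ, Continuous C → Continuous fun p : ℝ × ℝ => Real.exp (-p.1) • C p.2
      + ∫ v in (0 : ℝ)..1, (p.1 * Real.exp (-p.1 + p.1 * v)) • C (p.2 * √(1 - v ^ 2)) := by
    intro C hC
    refine Continuous.add (by fun_prop) ?_
    refine intervalIntegral.continuous_parametric_intervalIntegral_of_continuous' ?_ _ _
    simp only [Function.uncurry_def]
    fun_prop
  rw [integral_stationaryLaw ha hρ]
  refine (((hcont _ (continuous_integral_uniformCircle f)).tendsto (a, ρ)).comp
    (hA.prodMk_nhds hR)).congr' ?_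
  filter_upwards [hA.eventually (lt_mem_nhds ha), hR.eventually (lt_mem_nhds hρ)] with i h1 h2
  rw [integral_stationaryLaw h1 h2]
  rfl

/-- Off the limiting circle, `x` eventually stays on one side of the moving circle, so a single
branch of the definition applies. -/
theorem tendsto_stationaryDensityAC {ι : Type*} {l : Filter ι} {A R : ι → ℝ} {a ρ : ℝ}
    (hρ : 0 < ρ) (hA : Tendsto A l (𝓝 a)) (hR : Tendsto R l (𝓝 ρ)) {x : Plane} (hx : ‖x‖ ≠ ρ) :
    Tendsto (fun i => stationaryDensityAC (A i) (R i) x) l (𝓝 (stationaryDensityAC a ρ x)) := by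
  rcases lt_or_gt_of_ne hx with h | h
  · have hpos : 0 < ρ ^ 2 - ‖x‖ ^ 2 := by nlinarith [norm_nonneg x]
    have hpi := Real.pi_pos
    have hs : Tendsto (fun i => √(R i ^ 2 - ‖x‖ ^ 2)) l (𝓝 √(ρ ^ 2 - ‖x‖ ^ 2)) :=
      ((hR.pow 2).sub_const _).sqrt
    rw [stationaryDensityAC, if_pos h]
    refine Tendsto.congr' ?_ ((hA.div (hR.const_mul (2 * Real.pi)) (by positivity)).mul
      (((hA.neg.add ((hA.div hR hρ.ne').mul hs)).rexp).div hs (by positivity)))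
    filter_upwards [hR.eventually (lt_mem_nhds h)] with i hi
    rw [stationaryDensityAC, if_pos hi]
    rfl
  · rw [stationaryDensityAC, if_neg h.not_gt]
    refine tendsto_const_nhds.congr' ?_
    filter_upwards [hR.eventually (gt_mem_nhds h)] with i hi
    rw [stationaryDensityAC, if_neg (not_lt.2 (le_of_lt hi))]

theorem IsMarkovRandomFlight.aemeasurable_and_map {Ω : Type*} [MeasurableSpace Ω] {P : Measure Ω}
    [IsProbabilityMeasure P] {lam c : ℝ} (hlam : 0 < lam) (hc : 0 < c) {X : ℝ → Ω → Plane}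
    (hX : IsMarkovRandomFlight P lam c X) {s : ℝ} (hs : 0 < s) :
    AEMeasurable (X s) P ∧ P.map (X s) = transitionLaw lam c s := by
  obtain ⟨τ, u, h1, h2, h3, h4, h5, h6, h7, h8⟩ := hX
  have h : IsFlightDriver P lam τ u := ⟨h1, h2, h3, h4, h5, h6, h7⟩
  have he : (fun ω => position c (fun k => τ k ω) (fun k => u k ω) s) =ᵐ[P] X s := by
    filter_upwards [h8] with ω hω
    exact (hω s hs.le).symm
  exact ⟨(h.aemeasurable_position hlam c hs.le).congr he, by
    rw [← Measure.map_congr he, h.map_position hlam hc hs, transitionLaw_eq lam c hs.ne']⟩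

end RandomFlight

end

theorem mainTheorem2 {ι : Type*} (l : Filter ι)
    {Ω : ι → Type*} [∀ i, MeasurableSpace (Ω i)]
    (P : ∀ i, Measure (Ω i)) [∀ i, IsProbabilityMeasure (P i)]
    (lam c t : ι → ℝ) (hlam : ∀ i, 0 < lam i) (hc : ∀ i, 0 < c i)
    (X : ∀ i, ℝ → Ω i → RandomFlight.Plane)
    (hX : ∀ i, RandomFlight.IsMarkovRandomFlight (P i) (lam i) (c i) (X i))
    (a ρ : ℝ) (ha : 0 < a) (hρ : 0 < ρ)
    (hSDC : RandomFlight.SlowDiffusion l lam c t a ρ) :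
    -- the law of the flight at any time, with its singular and absolutely continuous parts
    (∀ i, ∀ s : ℝ, 0 < s →
      AEMeasurable (X i s) (P i) ∧
      (P i).map (X i s) = RandomFlight.transitionLaw (lam i) (c i) s) ∧
    -- weak convergence of the singular part
    (∀ f : BoundedContinuousFunction RandomFlight.Plane ℝ,
      Tendsto (fun i => Real.exp (-(lam i * t i))
          * ∫ x, f x ∂(RandomFlight.uniformCircle (c i * t i))) l
        (𝓝 (Real.exp (-a) * ∫ x, f x ∂(RandomFlight.uniformCircle ρ)))) ∧
    -- pointwise convergence of the absolutely continuous part, off the limiting circle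
    (∀ x : RandomFlight.Plane, ‖x‖ ≠ ρ →
      Tendsto (fun i => RandomFlight.transitionDensityAC (lam i) (c i) (t i) x) l
        (𝓝 (RandomFlight.stationaryDensityAC a ρ x))) ∧
    -- the limit is a probability law, and the laws of the flight converge weakly to it
    IsProbabilityMeasure (RandomFlight.stationaryLaw a ρ) ∧
    (∀ f : BoundedContinuousFunction RandomFlight.Plane ℝ,
      Tendsto (fun i => ∫ ω, f (X i (t i) ω) ∂(P i)) l
        (𝓝 (∫ x, f x ∂(RandomFlight.stationaryLaw a ρ)))) := by
  -- The times are positive only eventually, and the scaling identity divides by them.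
  have hpos := hSDC.time_tendsto.eventually (eventually_gt_atTop 0)
  refine ⟨fun i s hs => (hX i).aemeasurable_and_map (hlam i) (hc i) hs, fun f => ?_,
    fun x hx => ?_, RandomFlight.isProbabilityMeasure_stationaryLaw ha hρ, fun f => ?_⟩
  · exact hSDC.rate_mul_time.neg.rexp.mul
      (((RandomFlight.continuous_integral_uniformCircle f).tendsto ρ).comp hSDC.speed_mul_time)
  · refine (RandomFlight.tendsto_stationaryDensityAC hρ hSDC.rate_mul_time hSDC.speed_mul_time
      hx).congr' ?_
    filter_upwards [hpos] with i hi
    rw [RandomFlight.transitionDensityAC_eq _ _ hi.ne']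
  · refine (RandomFlight.tendsto_integral_stationaryLaw ha hρ hSDC.rate_mul_time
      hSDC.speed_mul_time f).congr' ?_
    filter_upwards [hpos] with i hi
    obtain ⟨hm, hl⟩ := (hX i).aemeasurable_and_map (hlam i) (hc i) hi
    rw [← RandomFlight.transitionLaw_eq _ _ hi.ne', ← hl,
      integral_map hm f.continuous.aestronglyMeasurable]
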